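/- Let $0<\gamma<1$, $a<b$, $c<d$, $T>0$, $\Omega=(a,b)\times(c,d)$, and $\delta(s,t)=(s^2+t^2)^{\gamma/2}$. Let $u$ be the exact solution of $$\frac{\partial u}{\partial t}(x,y,t)+\int_\Omega\frac{u(x,y,t)-u(\bar x,\bar y,t)}{\delta(x-\bar x,y-\bar y)}\,d\bar x\,d\bar y=f(x,y,t),\qquad (x,y,t)\in\Omega\times(0,T],$$ with boundary values $u=g$ on $\partial\Omega\times(0,T]$ and initial values $u(\cdot,\cdot,0)=u_0$ in $\Omega$ (the time derivative at $t=T$ is one-sided). Assume that $u(\cdot,\cdot,t)\in C^6([a,b]\times[c,d])$ with all derivatives of order at most $6$ bounded uniformly in $t\in[0,T]$, and that $u(x,y,\cdot)\in C^3([0,T])$ with derivatives of order at most $3$ bounded uniformly in $(x,y)\in[a,b]\times[c,d]$. For integers $M_x,M_y\ge 1$ let $h_x=(b-a)/M_x$, $h_y=(d-c)/M_y$, $x_{i/2}=a+\tfrac i2h_x$ $(0\le i\le 2M_x)$, $y_{j/2}=c+\tfrac j2h_y$ $(0\le j\le 2M_y)$. Let $\phi_{l/2}$ $(0\le l\le 2M_x)$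 be the continuous functions on $[a,b]$ that are quadratic polynomials on each cell $[x_{m-1},x_m]$, $1\le m\le M_x$, with $\phi_{l/2}(x_{i/2})=1$ if $i=l$ and $0$ otherwise, and let $\phi_{r/2}(\bar y)$ $(0\le r\le 2M_y)$ be the analogous functions on $[c,d]$ for the mesh $y_{j/2}$. Put $$d_{i,j}=\int_\Omega\frac{d\bar x\,d\bar y}{\delta(x_{i/2}-\bar x,y_{j/2}-\bar y)},\qquad g_{i,j}^{l,r}=\int_\Omega\frac{\phi_{l/2}(\bar x)\,\phi_{r/2}(\bar y)}{\delta(x_{i/2}-\bar x,y_{j/2}-\bar y)}\,d\bar x\,d\bar y .$$ Let $\mathcal A=\mathcal D-\mathcal G$ be the matrix whose rows and columns are indexed by the pairs $(i,j)$ with $1\le i\le 2M_x-1$, $1\le j\le 2M_y-1$, where $\mathcal D=\mathrm{diag}(d_{i,j})$ and $\mathcal G=(g_{i,j}^{l,r})_{(i,j),(l,r)}$. For $\tau>0$ and an integer $N\ge 0$ with $N\tau\le T$, let $t_k=k\tau$ and consider the Crank–Nicolson scheme $$\Bigl(I+\frac\tau2\mathcal A\Bigr)U^k=\Bigl(I-\frac\tau2\mathcal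 A\Bigr)U^{k-1}+\tau F^{k-\frac12}+\tau K^{k-\frac12},\qquad k=1,\dots,N,$$ for vectors $U^k=(u^k_{i/2,j/2})$, with $u^0_{i/2,j/2}=u_0(x_{i/2},y_{j/2})$, where $F^{k-\frac12}$ has the entries $f(x_{i/2},y_{j/2},(k-\tfrac12)\tau)$ and $K^{k-\frac12}$ has the entries $$\sum_{(l,r)} g_{i,j}^{l,r}\,g\bigl(x_{l/2},y_{r/2},(k-\tfrac12)\tau\bigr),$$ the sum being over those $(l,r)$ with $0\le l\le 2M_x$, $0\le r\le 2M_y$ and $l\in\{0,2M_x\}$ or $r\in\{0,2M_y\}$. Let $C_d=\dfrac{2(b-a)(d-c)^{1-\gamma}}{1-\gamma}$ and $\tau_0=\dfrac1{10C_d}$. Then there is a constant $C$, independent of $M_x,M_y,N,\tau$, such that for all $M_x,M_y\ge1$, all $0<\tau<\tau_0$ and all $N$ with $N\tau\le T$ the scheme has exactly one solution, and this solution satisfies $$\bigl|u(x_{i/2},y_{j/2},t_k)-u^k_{i/2,j/2}\bigr|\le C\bigl(\tau^2+h_x^{4-\gamma}+h_y^{4-\gamma}\bigr)$$ for $1\le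 i\le 2M_x-1$, $1\le j\le 2M_y-1$, $0\le k\le N$. -/

import Mathlib

open MeasureTheory Set

namespace Nonlocal2D

noncomputable section

/-- The open rectangle `Ω = (a, b) × (c, d)`. -/
def Omega (a b c d : ℝ) : Set (ℝ × ℝ) := Ioo a b ×ˢ Ioo c d

/-- The function `δ(s, t) = |√(s² + t²)| ^ γ`; the additive Cauchy kernel is its reciprocal. -/
def delta (γ s t : ℝ) : ℝ := |Real.sqrt (s ^ 2 + t ^ 2)| ^ γ

/-- `u` is a solution on `Ω × (0, T]` of
`∂u/∂t (x,y,t) + ∫_Ω (u(x,y,t) - u(x',y',t)) / δ(x - x', y - y') dx' dy' = f(x,y,t)`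
with Dirichlet boundary values `g` on `∂Ω` and initial value `u₀`.
The time derivative is taken within `[0, T]`, so that it is one-sided at `t = T`. -/
structure IsExactSolution (γ a b c d T : ℝ) (f g : ℝ → ℝ → ℝ → ℝ) (u₀ : ℝ → ℝ → ℝ)
    (u : ℝ → ℝ → ℝ → ℝ) : Prop where
  equation : ∀ x y t, (x, y) ∈ Omega a b c d → t ∈ Ioc 0 T →
    HasDerivWithinAt (fun s => u x y s)
      (f x y t - ∫ q in Omega a b c d, (u x y t - u q.1 q.2 t) / delta γ (x - q.1) (y - q.2))
      (Icc 0 T) t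
  boundary : ∀ x y t, (x, y) ∈ frontier (Omega a b c d) → t ∈ Ioc 0 T → u x y t = g x y t
  initial : ∀ x y, (x, y) ∈ Omega a b c d → u x y 0 = u₀ x y

/-- Smoothness of a function on `[a, b] × [c, d] × [0, T]`: of class `C⁶` in space with
derivatives bounded uniformly in time, and of class `C³` in time with derivatives bounded
uniformly in space. Every function that is jointly of class `C⁶` qualifies. -/
structure IsSmooth (a b c d T : ℝ) (u : ℝ → ℝ → ℝ → ℝ) : Prop where
  space : ∀ t ∈ Icc 0 T,
    ContDiffOn ℝ 6 (fun p : ℝ × ℝ => u p.1 p.2 t) (Icc a b ×ˢ Icc c d)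
  space_bound : ∃ B : ℝ, ∀ t ∈ Icc 0 T, ∀ p ∈ Icc a b ×ˢ Icc c d, ∀ m : ℕ, m ≤ 6 →
    ‖iteratedFDerivWithin ℝ m (fun p : ℝ × ℝ => u p.1 p.2 t) (Icc a b ×ˢ Icc c d) p‖ ≤ B
  time : ∀ x ∈ Icc a b, ∀ y ∈ Icc c d, ContDiffOn ℝ 3 (fun t => u x y t) (Icc 0 T)
  time_bound : ∃ B : ℝ, ∀ x ∈ Icc a b, ∀ y ∈ Icc c d, ∀ t ∈ Icc 0 T, ∀ m : ℕ, m ≤ 3 →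
    |iteratedDerivWithin m (fun t => u x y t) (Icc 0 T) t| ≤ B

/-- The uniform mesh size `(b - a) / M`. -/
def meshSize (a b : ℝ) (M : ℕ) : ℝ := (b - a) / M

/-- The mesh point `x_{i/2} = a + (i/2) h`, for `0 ≤ i ≤ 2M`. -/
def node (a b : ℝ) (M i : ℕ) : ℝ := a + (i / 2 : ℝ) * meshSize a b M

/-- The piecewise quadratic Lagrange basis function `φ_{i/2}` on `[a, b]`, for `0 ≤ i ≤ 2M`.
For even `i` it belongs to an end point of the cells of length `h`, for odd `i` to the midpoint of
a cell. For `i = 0` and `i = 2M` one of the two branches lies outside `(a, b)`; the basis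
functions are only ever integrated over `(a, b)`. -/
def basisFun (a b : ℝ) (M i : ℕ) (x : ℝ) : ℝ :=
  let h := meshSize a b M
  let z := node a b M i
  if Even i then
    if x ∈ Icc (z - h) z then (x - (z - h)) / h * ((2 * x - (z + (z - h))) / h)
    else if x ∈ Icc z (z + h) then ((z + h) - x) / h * ((((z + h) + z) - 2 * x) / h)
    else 0
  else
    if x ∈ Icc (z - h / 2) (z + h / 2) then
      4 * (x - (z - h / 2)) * ((z + h / 2) - x) / h ^ 2
    else 0

/-- The diagonal coefficient `∫_Ω 1 / δ(x_{i/2} - x', y_{j/2} - y') dx' dy'`. -/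
def diagCoeff (γ a b c d : ℝ) (Mx My i j : ℕ) : ℝ :=
  ∫ q in Omega a b c d, 1 / delta γ (node a b Mx i - q.1) (node c d My j - q.2)

/-- The coefficient
`∫_Ω φ_{l/2}(x') φ_{r/2}(y') / δ(x_{i/2} - x', y_{j/2} - y') dx' dy'`. -/
def basisCoeff (γ a b c d : ℝ) (Mx My i j l r : ℕ) : ℝ :=
  ∫ q in Omega a b c d, basisFun a b Mx l q.1 * basisFun c d My r q.2 /
    delta γ (node a b Mx i - q.1) (node c d My j - q.2)

/-- Indices of the interior collocation points: `(i, j)` stands for the point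
`(x_{(i+1)/2}, y_{(j+1)/2})`, where `1 ≤ i + 1 ≤ 2 Mx - 1` and `1 ≤ j + 1 ≤ 2 My - 1`. -/
abbrev Index (Mx My : ℕ) : Type := Fin (2 * Mx - 1) × Fin (2 * My - 1)

/-- The values of a function at the interior collocation points. -/
def gridFun (a b c d : ℝ) (Mx My : ℕ) (v : ℝ → ℝ → ℝ) : Index Mx My → ℝ :=
  fun p => v (node a b Mx (p.1 + 1)) (node c d My (p.2 + 1))

/-- The diagonal matrix `D`. -/
def matD (γ a b c d : ℝ) (Mx My : ℕ) : Matrix (Index Mx My) (Index Mx My) ℝ :=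
  Matrix.diagonal fun p => diagCoeff γ a b c d Mx My (p.1 + 1) (p.2 + 1)

/-- The full matrix `G`. -/
def matG (γ a b c d : ℝ) (Mx My : ℕ) : Matrix (Index Mx My) (Index Mx My) ℝ :=
  Matrix.of fun p q =>
    basisCoeff γ a b c d Mx My (p.1 + 1) (p.2 + 1) (q.1 + 1) (q.2 + 1)

/-- The stiffness matrix `A = D - G`. -/
def matA (γ a b c d : ℝ) (Mx My : ℕ) : Matrix (Index Mx My) (Index Mx My) ℝ :=
  matD γ a b c d Mx My - matG γ a b c d Mx My

/-- The boundary vector `K` that belongs to the boundary values `w`: the contribution of the mesh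
points on `∂Ω` to the integral of the piecewise quadratic interpolant. -/
def boundaryVec (γ a b c d : ℝ) (Mx My : ℕ) (w : ℝ → ℝ → ℝ) : Index Mx My → ℝ :=
  fun p =>
    let G := basisCoeff γ a b c d Mx My (p.1 + 1) (p.2 + 1)
    (∑ r ∈ Finset.Icc 0 (2 * My), G 0 r * w (node a b Mx 0) (node c d My r))
    + (∑ r ∈ Finset.Icc 0 (2 * My), G (2 * Mx) r * w (node a b Mx (2 * Mx)) (node c d My r))
    + (∑ l ∈ Finset.Icc 1 (2 * Mx - 1), G l 0 * w (node a b Mx l) (node c d My 0))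
    + (∑ l ∈ Finset.Icc 1 (2 * Mx - 1),
        G l (2 * My) * w (node a b Mx l) (node c d My (2 * My)))

/-- `U⁰, …, U^N` is a solution of the Crank-Nicolson collocation scheme
`(I + τ/2 A) U^k = (I - τ/2 A) U^{k-1} + τ F^{k-1/2} + τ K^{k-1/2}`, `k = 1, …, N`,
with data `f` and `g` taken at `t_{k-1/2} = (k - 1/2) τ`, started from the exact initial values.
(Below `k` runs over `0, …, N - 1` and stands for `k - 1`.) -/
structure IsSchemeSolution (γ a b c d : ℝ) (f g : ℝ → ℝ → ℝ → ℝ) (u₀ : ℝ → ℝ → ℝ)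
    (Mx My N : ℕ) (τ : ℝ) (U : Fin (N + 1) → Index Mx My → ℝ) : Prop where
  start : U 0 = gridFun a b c d Mx My u₀
  step : ∀ k : Fin N,
    (1 + (τ / 2) • matA γ a b c d Mx My).mulVec (U k.succ) =
      (1 - (τ / 2) • matA γ a b c d Mx My).mulVec (U k.castSucc)
      + τ • gridFun a b c d Mx My (fun x y => f x y (((k : ℝ) + 1 / 2) * τ))
      + τ • boundaryVec γ a b c d Mx My (fun x y => g x y (((k : ℝ) + 1 / 2) * τ))

/-- The constant `C_d = 2 (b - a) (d - c)^{1-γ} / (1 - γ)`. -/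
def constCd (γ a b c d : ℝ) : ℝ := 2 * (b - a) * (d - c) ^ (1 - γ) / (1 - γ)

end

end Nonlocal2D

namespace Nonlocal2D

/-! ### The piecewise quadratic basis -/

/-! Convergence is consistency plus stability in the maximum norm. The stability half is soft: the
kernel is weakly singular, so the nonlocal operator is bounded. Its row integrals are at most
`constCd`, a tensor product of basis functions has absolute sum at most 3 · 3, and hence
`norm_matA_mulVec_le` bounds `matA` by `10 * constCd` on every mesh. For τ below the reciprocal of
this bound the implicit matrix is injective, and `discrete_gronwall` sums the local errors. No sign
or dominance property of the matrix is needed.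

The substance is the spatial rate 4 - γ. Piecewise quadratic interpolation is only of third order
pointwise, but on each cell its error is a multiple of s(s - h/2)(s - h) up to O(h⁴)
(`HasCubicExpansion.interpErr_cell`). This cubic has mean zero over the cell, so the primitive of
the error is O(h⁴) throughout (`HasCubicExpansion.abs_integral_le`). Against the kernel
(`abs_integral_mul_kernel_le`), the part within h of the singularity gives h³ · h^(1-γ) by the
pointwise bound. On the rest the kernel is monotone on each side and at most h^(-γ), so integration
by parts gives h⁴ · h^(-γ). Both are h^(4-γ), uniformly in the transverse coordinate, and Fubini
together with the splitting `sub_tensorSum_eq` carries the rate to the rectangle.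

In time, the scheme is compared with the equation at the midpoint of a step. Taylor expansion makes
the difference quotient and the average second-order accurate there, and boundedness of `matA` lets
it act on the averaging error at no cost in h. -/

theorem meshSize_pos {a b : ℝ} {M : ℕ} (hab : a < b) (hM : 1 ≤ M) : 0 < meshSize a b M := by
  have : (0 : ℝ) < M := by exact_mod_cast hM
  exact div_pos (sub_pos.2 hab) this

theorem meshSize_le {a b : ℝ} {M : ℕ} (hab : a < b) (hM : 1 ≤ M) : meshSize a b M ≤ b - a :=
  div_le_self (sub_pos.2 hab).le (by exact_mod_cast hM)

theorem mul_meshSize {a b : ℝ} {M : ℕ} (hM : 1 ≤ M) : (M : ℝ) * meshSize a b M = b - a := by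
  have : (0 : ℝ) < M := by exact_mod_cast hM
  unfold meshSize
  field_simp

theorem node_zero (a b : ℝ) (M : ℕ) : node a b M 0 = a := by simp [node]

theorem node_two_mul {a b : ℝ} {M : ℕ} (hM : 1 ≤ M) : node a b M (2 * M) = b := by
  have := mul_meshSize (a := a) (b := b) hM
  unfold node
  push_cast
  linarith

theorem node_le_node {a b : ℝ} {M i j : ℕ} (hab : a < b) (hM : 1 ≤ M) (hij : i ≤ j) :
    node a b M i ≤ node a b M j := by
  have := (meshSize_pos hab hM).le
  unfold node
  gcongr

theorem node_lt_node {a b : ℝ} {M i j : ℕ} (hab : a < b) (hM : 1 ≤ M) (hij : i < j) :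
    node a b M i < node a b M j := by
  have := meshSize_pos hab hM
  unfold node
  gcongr

theorem node_mem_Icc {a b : ℝ} {M i : ℕ} (hab : a < b) (hM : 1 ≤ M) (hi : i ≤ 2 * M) :
    node a b M i ∈ Icc a b := by
  constructor
  · simpa [node_zero] using node_le_node (i := 0) hab hM (Nat.zero_le i)
  · simpa [node_two_mul hM] using node_le_node hab hM hi

theorem node_mem_Ioo {a b : ℝ} {M i : ℕ} (hab : a < b) (hM : 1 ≤ M) (hi0 : 0 < i)
    (hi : i < 2 * M) : node a b M i ∈ Ioo a b := by
  constructor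
  · simpa [node_zero] using node_lt_node hab hM hi0
  · simpa [node_two_mul hM] using node_lt_node hab hM hi

/-- A hat function times a linear factor in the scaled distance from the node. In this form, free of
case distinctions, continuity is evident. -/
theorem basisFun_of_even {a b : ℝ} {M i : ℕ} (hab : a < b) (hM : 1 ≤ M) (hi : Even i) (x : ℝ) :
    basisFun a b M i x = max 0 (1 - |x - node a b M i| / meshSize a b M) *
      (1 - 2 * (|x - node a b M i| / meshSize a b M)) := by
  have hh := meshSize_pos hab hM
  simp only [basisFun, if_pos hi, mem_Icc]
  set h := meshSize a b M
  set z := node a b M i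
  split_ifs with h1 h2
  · have h3 : |x - z| = z - x := by rw [abs_of_nonpos (by linarith)]; ring
    have h4 : (z - x) / h ≤ 1 := (div_le_one hh).2 (by linarith)
    rw [h3, max_eq_right (by linarith)]
    field_simp
    ring
  · have h3 : |x - z| = x - z := abs_of_nonneg (by linarith)
    have h4 : (x - z) / h ≤ 1 := (div_le_one hh).2 (by linarith)
    rw [h3, max_eq_right (by linarith)]
    field_simp
    ring
  · have h3 : h ≤ |x - z| := by
      by_contra! h4
      rw [abs_lt] at h4
      rcases le_total x z with h5 | h5
      · exact h1 ⟨by linarith, h5⟩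
      · exact h2 ⟨h5, by linarith⟩
    have h4 : 1 ≤ |x - z| / h := (one_le_div hh).2 h3
    rw [max_eq_left (by linarith), zero_mul]

theorem basisFun_of_odd {a b : ℝ} {M i : ℕ} (hab : a < b) (hM : 1 ≤ M) (hi : ¬Even i) (x : ℝ) :
    basisFun a b M i x = max 0 (1 - 4 * ((x - node a b M i) / meshSize a b M) ^ 2) := by
  have hh := meshSize_pos hab hM
  simp only [basisFun, if_neg hi, mem_Icc]
  set h := meshSize a b M
  set z := node a b M i
  have key : 4 * (x - (z - h / 2)) * ((z + h / 2) - x) / h ^ 2 = 1 - 4 * ((x - z) / h) ^ 2 := by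
    field_simp
    ring
  rw [key]
  split_ifs with h1
  · rw [max_eq_right]
    rw [← key]
    have h2 : 0 ≤ x - (z - h / 2) := by linarith
    have h3 : 0 ≤ (z + h / 2) - x := by linarith
    positivity
  · rw [max_eq_left]
    rw [← key]
    apply div_nonpos_of_nonpos_of_nonneg _ (by positivity)
    rcases lt_or_ge x (z - h / 2) with h2 | h2
    · nlinarith
    · have h3 : z + h / 2 < x := by
        by_contra! h3
        exact h1 ⟨h2, h3⟩
      nlinarith

theorem continuous_basisFun {a b : ℝ} {M : ℕ} (hab : a < b) (hM : 1 ≤ M) (i : ℕ) :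
    Continuous (basisFun a b M i) := by
  by_cases hi : Even i
  · rw [funext (basisFun_of_even hab hM hi)]
    fun_prop
  · rw [funext (basisFun_of_odd hab hM hi)]
    fun_prop

theorem abs_basisFun_le_one {a b : ℝ} {M : ℕ} (hab : a < b) (hM : 1 ≤ M) (i : ℕ) (x : ℝ) :
    |basisFun a b M i x| ≤ 1 := by
  have hh := meshSize_pos hab hM
  by_cases hi : Even i
  · rw [basisFun_of_even hab hM hi]
    have hs : 0 ≤ |x - node a b M i| / meshSize a b M := by positivity
    generalize |x - node a b M i| / meshSize a b M = s at hs
    rcases le_total (1 - s) 0 with h | h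
    · simp [max_eq_left h]
    · rw [max_eq_right h, abs_le]
      -- (1 - s)(1 - 2s) = ((4s - 3)² - 1) / 8, which is at least -1/8.
      constructor <;> nlinarith [sq_nonneg (4 * s - 3)]
  · rw [basisFun_of_odd hab hM hi, abs_of_nonneg (le_max_left _ _)]
    exact max_le zero_le_one (by nlinarith [sq_nonneg ((x - node a b M i) / meshSize a b M)])

/-- The left end point of the `m`-th cell. -/
noncomputable def cellLeft (a b : ℝ) (M m : ℕ) : ℝ := a + m * meshSize a b M

theorem cellLeft_succ (a b : ℝ) (M m : ℕ) :
    cellLeft a b M (m + 1) = cellLeft a b M m + meshSize a b M := by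
  unfold cellLeft
  push_cast
  ring

theorem node_two_mul_eq (a b : ℝ) (M m : ℕ) : node a b M (2 * m) = cellLeft a b M m := by
  unfold node cellLeft
  push_cast
  ring

theorem node_two_mul_add_one (a b : ℝ) (M m : ℕ) :
    node a b M (2 * m + 1) = cellLeft a b M m + meshSize a b M / 2 := by
  unfold node cellLeft
  push_cast
  ring

theorem node_two_mul_add_two (a b : ℝ) (M m : ℕ) :
    node a b M (2 * m + 2) = cellLeft a b M m + meshSize a b M := by
  unfold node cellLeft
  push_cast
  ring

theorem cellLeft_mem_Icc {a b : ℝ} {M m : ℕ} (hab : a < b) (hM : 1 ≤ M) (hm : m ≤ M) :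
    cellLeft a b M m ∈ Icc a b := by
  rw [← node_two_mul_eq]
  exact node_mem_Icc hab hM (by omega)

theorem exists_mem_cell {a b : ℝ} {M : ℕ} (hab : a < b) (hM : 1 ≤ M) {x : ℝ} (hx : x ∈ Icc a b) :
    ∃ m < M, x ∈ Icc (cellLeft a b M m) (cellLeft a b M m + meshSize a b M) := by
  have hh := meshSize_pos hab hM
  have hMh := mul_meshSize (a := a) (b := b) hM
  rcases hx.2.eq_or_lt with rfl | hxb
  -- At the right end point the floor would give `M`, one past the last cell.
  · refine ⟨M - 1, by omega, ?_, ?_⟩ <;>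
    · unfold cellLeft
      push_cast [hM]
      linarith
  · have h0 : 0 ≤ (x - a) / meshSize a b M := div_nonneg (sub_nonneg.2 hx.1) hh.le
    refine ⟨⌊(x - a) / meshSize a b M⌋₊, ?_, ?_, ?_⟩
    · rw [Nat.floor_lt h0, div_lt_iff₀ hh]
      linarith
    · have := Nat.floor_le h0
      rw [le_div_iff₀ hh] at this
      unfold cellLeft
      linarith
    · have := Nat.lt_floor_add_one ((x - a) / meshSize a b M)
      rw [div_lt_iff₀ hh] at this
      unfold cellLeft
      linarith

theorem basisFun_eq_zero_of_mem_cell {a b : ℝ} {M m l : ℕ} (hab : a < b) (hM : 1 ≤ M) {x : ℝ}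
    (hx : x ∈ Icc (cellLeft a b M m) (cellLeft a b M m + meshSize a b M))
    (h0 : l ≠ 2 * m) (h1 : l ≠ 2 * m + 1) (h2 : l ≠ 2 * m + 2) : basisFun a b M l x = 0 := by
  have hh := meshSize_pos hab hM
  obtain ⟨hx1, hx2⟩ := hx
  unfold cellLeft at hx1 hx2
  by_cases hl : Even l
  · rw [basisFun_of_even hab hM hl, max_eq_left, zero_mul]
    rw [sub_nonpos, one_le_div hh]
    obtain ⟨k, rfl⟩ := hl
    have hk : node a b M (k + k) = a + k * meshSize a b M := by
      unfold node
      push_cast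
      ring
    rw [hk]
    rcases lt_or_ge k m with h | h
    · have : (k : ℝ) + 1 ≤ m := by exact_mod_cast h
      refine le_trans ?_ (le_abs_self _)
      nlinarith
    -- The excluded indices rule out `k = m` and `k = m + 1`, so the node lies at least one mesh
    -- size beyond the cell.
    · have : (m : ℝ) + 2 ≤ k := by exact_mod_cast (show m + 2 ≤ k by omega)
      refine le_trans ?_ (neg_le_abs _)
      nlinarith
  · rw [basisFun_of_odd hab hM hl, max_eq_left]
    obtain ⟨k, rfl⟩ := Nat.not_even_iff_odd.1 hl
    have hk : node a b M (2 * k + 1) = a + (k + 1 / 2) * meshSize a b M := by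
      unfold node
      push_cast
      ring
    rw [hk]
    suffices h : (1 / 2) ^ 2 ≤ ((x - (a + (k + 1 / 2) * meshSize a b M)) / meshSize a b M) ^ 2 by
      linarith
    rw [sq_le_sq, abs_of_pos (by norm_num : (0 : ℝ) < 1 / 2), abs_div, abs_of_pos hh,
      le_div_iff₀ hh]
    rcases lt_or_ge k m with h | h
    · have : (k : ℝ) + 1 ≤ m := by exact_mod_cast h
      refine le_trans ?_ (le_abs_self _)
      nlinarith
    · have : (m : ℝ) + 1 ≤ k := by exact_mod_cast (show m + 1 ≤ k by omega)
      refine le_trans ?_ (neg_le_abs _)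
      nlinarith

theorem sum_range_of_cell {M m : ℕ} (hm : m < M) (F : ℕ → ℝ)
    (hF : ∀ l, l ≠ 2 * m → l ≠ 2 * m + 1 → l ≠ 2 * m + 2 → F l = 0) :
    ∑ l ∈ Finset.range (2 * M + 1), F l = F (2 * m) + F (2 * m + 1) + F (2 * m + 2) := by
  rw [← Finset.sum_subset (s₁ := {2 * m, 2 * m + 1, 2 * m + 2})]
  · rw [Finset.sum_insert (by simp), Finset.sum_insert (by simp), Finset.sum_singleton, add_assoc]
  · intro l hl
    simp only [Finset.mem_insert, Finset.mem_singleton, Finset.mem_range] at hl ⊢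
    omega
  · intro l _ hl
    simp only [Finset.mem_insert, Finset.mem_singleton, not_or] at hl
    exact hF l hl.1 hl.2.1 hl.2.2

/-- Only three basis functions live on a cell, each bounded by 1. This crude Lebesgue constant is
the source of every factor 3 and 9 in the stability bounds. -/
theorem sum_abs_basisFun_le {a b : ℝ} {M : ℕ} (hab : a < b) (hM : 1 ≤ M) {x : ℝ}
    (hx : x ∈ Icc a b) : ∑ l ∈ Finset.range (2 * M + 1), |basisFun a b M l x| ≤ 3 := by
  obtain ⟨m, hm, hxm⟩ := exists_mem_cell hab hM hx
  rw [sum_range_of_cell hm]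
  · have := abs_basisFun_le_one hab hM
    linarith [this (2 * m) x, this (2 * m + 1) x, this (2 * m + 2) x]
  · intro l h0 h1 h2
    rw [basisFun_eq_zero_of_mem_cell hab hM hxm h0 h1 h2, abs_zero]

/-- The piecewise quadratic interpolant. -/
noncomputable def interp (a b : ℝ) (M : ℕ) (v : ℝ → ℝ) (x : ℝ) : ℝ :=
  ∑ l ∈ Finset.range (2 * M + 1), basisFun a b M l x * v (node a b M l)

theorem continuous_interp {a b : ℝ} {M : ℕ} (hab : a < b) (hM : 1 ≤ M) (v : ℝ → ℝ) :
    Continuous (interp a b M v) := by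
  have := continuous_basisFun hab hM
  unfold interp
  fun_prop

theorem abs_sum_basisFun_mul_le {a b : ℝ} {M : ℕ} (hab : a < b) (hM : 1 ≤ M) {x K : ℝ}
    (hx : x ∈ Icc a b) {w : ℕ → ℝ} (hw : ∀ l < 2 * M + 1, |w l| ≤ K) :
    |∑ l ∈ Finset.range (2 * M + 1), basisFun a b M l x * w l| ≤ 3 * K := by
  have hK : 0 ≤ K := (abs_nonneg _).trans (hw 0 (by omega))
  calc |∑ l ∈ Finset.range (2 * M + 1), basisFun a b M l x * w l|
      ≤ ∑ l ∈ Finset.range (2 * M + 1), |basisFun a b M l x * w l| :=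
        Finset.abs_sum_le_sum_abs _ _
    _ ≤ ∑ l ∈ Finset.range (2 * M + 1), |basisFun a b M l x| * K := by
        refine Finset.sum_le_sum fun l hl => ?_
        rw [abs_mul]
        exact mul_le_mul_of_nonneg_left (hw l (Finset.mem_range.1 hl)) (abs_nonneg _)
    _ ≤ 3 * K := by
        rw [← Finset.sum_mul]
        exact mul_le_mul_of_nonneg_right (sum_abs_basisFun_le hab hM hx) hK

/-- On a cell the interpolant is the quadratic Lagrange interpolant; `s` is the distance from the
left end of the cell. -/
theorem interp_eq_of_mem_cell {a b : ℝ} {M m : ℕ} (hab : a < b) (hM : 1 ≤ M) (hm : m < M)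
    (v : ℝ → ℝ) {s : ℝ} (hs0 : 0 ≤ s) (hs1 : s ≤ meshSize a b M) :
    interp a b M v (cellLeft a b M m + s) =
      (1 - s / meshSize a b M) * (1 - 2 * (s / meshSize a b M)) * v (cellLeft a b M m)
      + 4 * (s / meshSize a b M) * (1 - s / meshSize a b M)
          * v (cellLeft a b M m + meshSize a b M / 2)
      + (s / meshSize a b M) * (2 * (s / meshSize a b M) - 1)
          * v (cellLeft a b M m + meshSize a b M) := by
  have hh := meshSize_pos hab hM
  have hs : s / meshSize a b M ≤ 1 := (div_le_one hh).2 hs1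
  have hs' : 0 ≤ s / meshSize a b M := by positivity
  unfold interp
  rw [sum_range_of_cell hm]
  · rw [basisFun_of_even hab hM (by simp), basisFun_of_odd hab hM (by simp),
      basisFun_of_even hab hM (by simp [parity_simps]), node_two_mul_eq, node_two_mul_add_one,
      node_two_mul_add_two]
    set h := meshSize a b M
    have e1 : |cellLeft a b M m + s - cellLeft a b M m| / h = s / h := by
      rw [add_sub_cancel_left, abs_of_nonneg hs0]
    have e2 : (cellLeft a b M m + s - (cellLeft a b M m + h / 2)) / h = s / h - 1 / 2 := by
      field_simp
      ring
    have e3 : |cellLeft a b M m + s - (cellLeft a b M m + h)| / h = 1 - s / h := by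
      rw [add_sub_add_left_eq_sub, abs_of_nonpos (by linarith)]
      field_simp
      ring
    rw [e1, e2, e3, max_eq_right (by linarith), max_eq_right (by nlinarith),
      max_eq_right (by linarith)]
    ring
  · intro l h0 h1 h2
    rw [basisFun_eq_zero_of_mem_cell hab hM ⟨by linarith, by linarith⟩ h0 h1 h2, zero_mul]

/-! ### The one-dimensional interpolation error -/

/-- At every point of `[a, b]`, the function `v` has a one-sided expansion by a cubic polynomial,
with uniform bounds on the leading coefficient and on the remainder. -/
def HasCubicExpansion (a b B : ℝ) (v : ℝ → ℝ) : Prop :=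
  ∀ p ∈ Icc a b, ∃ c₀ c₁ c₂ c₃ : ℝ, |c₃| ≤ B ∧ ∀ s, 0 ≤ s → p + s ≤ b →
    |v (p + s) - (c₀ + c₁ * s + c₂ * s ^ 2 + c₃ * s ^ 3)| ≤ B * s ^ 4

/-- Taylor's formula is applied on an interval starting at the expansion point, while the derivative
bounds are given on the whole interval; this passes between the two. -/
theorem iteratedDerivWithin_Icc_left {f : ℝ → ℝ} {a b p y : ℝ} {n : ℕ}
    (hf : ContDiffOn ℝ n f (Icc a b)) (hap : a ≤ p) (hpb : p < b) (hy : y ∈ Icc p b) :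
    iteratedDerivWithin n f (Icc p b) y = iteratedDerivWithin n f (Icc a b) y := by
  unfold iteratedDerivWithin
  rw [iteratedFDerivWithin_subset (Icc_subset_Icc_left hap) (uniqueDiffOn_Icc hpb)
    (uniqueDiffOn_Icc (hap.trans_lt hpb)) hf hy]

theorem hasCubicExpansion_of_contDiffOn {a b B : ℝ} {v : ℝ → ℝ}
    (hv : ContDiffOn ℝ 4 v (Icc a b))
    (hB : ∀ x ∈ Icc a b, ∀ m : ℕ, m ≤ 4 → |iteratedDerivWithin m v (Icc a b) x| ≤ B) :
    HasCubicExpansion a b B v := by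
  intro p hp
  have hB0 : 0 ≤ B := (abs_nonneg _).trans (hB p hp 0 (by norm_num))
  -- At the right end the interval `Icc p b` degenerates and only `s = 0` has to be covered.
  rcases hp.2.eq_or_lt with rfl | hpb
  · refine ⟨v p, 0, 0, 0, by simpa using hB0, fun s hs0 hs1 => ?_⟩
    obtain rfl : s = 0 := by linarith
    simp
  have hsub : Icc p b ⊆ Icc a b := Icc_subset_Icc_left hp.1
  refine ⟨v p, iteratedDerivWithin 1 v (Icc p b) p, iteratedDerivWithin 2 v (Icc p b) p / 2,
    iteratedDerivWithin 3 v (Icc p b) p / 6, ?_, fun s hs0 hs1 => ?_⟩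
  · rw [iteratedDerivWithin_Icc_left (hv.of_le (by norm_num)) hp.1 hpb (left_mem_Icc.2 hpb.le),
      abs_div, abs_of_pos (by norm_num : (0 : ℝ) < 6)]
    have := hB p hp 3 (by norm_num)
    linarith
  · have h1 := taylor_mean_remainder_bound (n := 3) (C := B) (x := p + s) hpb.le
      ((hv.mono hsub).of_le (by norm_num)) ⟨by linarith, hs1⟩ fun y hy => by
        rw [iteratedDerivWithin_Icc_left (by simpa using hv) hp.1 hpb hy]
        exact hB y (hsub hy) 4 le_rfl
    simp only [taylorWithinEval_succ, taylor_within_zero_eval, add_sub_cancel_left,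
      Real.norm_eq_abs, smul_eq_mul] at h1
    norm_num [Nat.factorial] at h1
    refine (le_of_eq ?_).trans (h1.trans ?_)
    · rw [iteratedDerivWithin_one]
      congr 1
      ring
    -- The factor 1/3! in the Taylor remainder is given away.
    · have : 0 ≤ B * s ^ 4 := by positivity
      linarith

/-- The error of piecewise quadratic interpolation. -/
noncomputable def interpErr (a b : ℝ) (M : ℕ) (v : ℝ → ℝ) (x : ℝ) : ℝ := v x - interp a b M v x

theorem continuousOn_interpErr {a b : ℝ} {M : ℕ} (hab : a < b) (hM : 1 ≤ M) {v : ℝ → ℝ}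
    (hv : ContinuousOn v (Icc a b)) : ContinuousOn (interpErr a b M v) (Icc a b) :=
  hv.sub (continuous_interp hab hM v).continuousOn

/-- Quadratics are reproduced, and the cubic term leaves its coefficient times the monic cubic
vanishing at the three nodes. The fourth-order remainder enters once at the evaluation point and
once at each node, with Lagrange weights at most 1 in modulus; hence the factor 4. -/
theorem HasCubicExpansion.interpErr_cell {a b B : ℝ} {v : ℝ → ℝ} {M m : ℕ}
    (hv : HasCubicExpansion a b B v) (hab : a < b) (hM : 1 ≤ M) (hm : m < M) :
    ∃ α : ℝ, |α| ≤ B ∧ ∀ s ∈ Icc 0 (meshSize a b M),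
      |interpErr a b M v (cellLeft a b M m + s)
        - α * (s * (s - meshSize a b M / 2) * (s - meshSize a b M))|
        ≤ 4 * B * meshSize a b M ^ 4 := by
  have hh := meshSize_pos hab hM
  obtain ⟨c₀, c₁, c₂, c₃, hc₃, hc⟩ := hv _ (cellLeft_mem_Icc hab hM hm.le)
  have hend := (cellLeft_mem_Icc hab hM (Nat.succ_le_of_lt hm)).2
  rw [Nat.succ_eq_add_one, cellLeft_succ] at hend
  have hB : 0 ≤ B := (abs_nonneg _).trans hc₃
  refine ⟨c₃, hc₃, fun s hs => ?_⟩
  unfold interpErr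
  rw [interp_eq_of_mem_cell hab hM hm v hs.1 hs.2]
  set h := meshSize a b M
  set p := cellLeft a b M m
  have bound : ∀ r ∈ Icc 0 h,
      |v (p + r) - (c₀ + c₁ * r + c₂ * r ^ 2 + c₃ * r ^ 3)| ≤ B * h ^ 4 := by
    intro r hr
    refine (hc r hr.1 (by linarith [hr.2])).trans ?_
    have := hr.1
    have := hr.2
    gcongr
  have b0 := bound 0 ⟨le_rfl, hh.le⟩
  have b1 := bound (h / 2) ⟨by linarith, by linarith⟩
  have b2 := bound h ⟨hh.le, le_rfl⟩
  have bs := bound s hs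
  rw [add_zero] at b0
  have hθ0 : 0 ≤ s / h := div_nonneg hs.1 hh.le
  have hθ1 : s / h ≤ 1 := (div_le_one hh).2 hs.2
  have hsθ : s = s / h * h := by field_simp
  set θ := s / h
  have k0 : |(1 - θ) * (1 - 2 * θ)| ≤ 1 := by
    rw [abs_le]
    constructor <;> nlinarith [sq_nonneg (4 * θ - 3)]
  have k1 : |4 * θ * (1 - θ)| ≤ 1 := by
    rw [abs_le]
    constructor <;> nlinarith [sq_nonneg (2 * θ - 1)]
  have k2 : |θ * (2 * θ - 1)| ≤ 1 := by
    rw [abs_le]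
    constructor <;> nlinarith [sq_nonneg (4 * θ - 1)]
  have mulb : ∀ {k e : ℝ}, |k| ≤ 1 → |e| ≤ B * h ^ 4 → |k * e| ≤ B * h ^ 4 := by
    intro k e hk he
    rw [abs_mul]
    calc |k| * |e| ≤ 1 * |e| := by gcongr
      _ ≤ _ := by rwa [one_mul]
  have t0 := abs_le.1 (mulb k0 b0)
  have t1 := abs_le.1 (mulb k1 b1)
  have t2 := abs_le.1 (mulb k2 b2)
  have ts := abs_le.1 bs
  have key : v (p + s) - ((1 - θ) * (1 - 2 * θ) * v p + 4 * θ * (1 - θ) * v (p + h / 2)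
        + θ * (2 * θ - 1) * v (p + h)) - c₃ * (s * (s - h / 2) * (s - h))
      = (v (p + s) - (c₀ + c₁ * s + c₂ * s ^ 2 + c₃ * s ^ 3))
        - (1 - θ) * (1 - 2 * θ) * (v p - (c₀ + c₁ * 0 + c₂ * 0 ^ 2 + c₃ * 0 ^ 3))
        - 4 * θ * (1 - θ)
          * (v (p + h / 2) - (c₀ + c₁ * (h / 2) + c₂ * (h / 2) ^ 2 + c₃ * (h / 2) ^ 3))
        - θ * (2 * θ - 1) * (v (p + h) - (c₀ + c₁ * h + c₂ * h ^ 2 + c₃ * h ^ 3)) := by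
    clear_value θ
    generalize v (p + s) = vs
    subst hsθ
    ring
  rw [key, abs_le]
  constructor <;> linarith

theorem HasCubicExpansion.abs_interpErr_le {a b B : ℝ} {v : ℝ → ℝ} {M : ℕ}
    (hv : HasCubicExpansion a b B v) (hab : a < b) (hM : 1 ≤ M) {x : ℝ} (hx : x ∈ Icc a b) :
    |interpErr a b M v x| ≤ B * (1 + 4 * (b - a)) * meshSize a b M ^ 3 := by
  have hh := meshSize_pos hab hM
  have hh' := meshSize_le hab hM
  obtain ⟨m, hm, hxm⟩ := exists_mem_cell hab hM hx
  obtain ⟨α, hα, hE⟩ := hv.interpErr_cell hab hM hm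
  have hB : 0 ≤ B := (abs_nonneg _).trans hα
  have hs : x - cellLeft a b M m ∈ Icc 0 (meshSize a b M) :=
    ⟨by linarith [hxm.1], by linarith [hxm.2]⟩
  have h1 := hE _ hs
  rw [add_sub_cancel] at h1
  set s := x - cellLeft a b M m
  set h := meshSize a b M
  have h2 : |α * (s * (s - h / 2) * (s - h))| ≤ B * (h * h * h) := by
    rw [abs_mul, abs_mul, abs_mul]
    have e1 : |s| ≤ h := abs_le.2 ⟨by linarith [hs.1], hs.2⟩
    have e2 : |s - h / 2| ≤ h := abs_le.2 ⟨by linarith [hs.1], by linarith [hs.2]⟩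
    have e3 : |s - h| ≤ h := abs_le.2 ⟨by linarith [hs.1], by linarith [hs.2]⟩
    gcongr
  -- One power of `h` is traded for the length of the interval, so that a single third-order term
  -- remains.
  have h3 : 4 * B * h ^ 4 ≤ 4 * B * ((b - a) * h ^ 3) := by
    rw [show h ^ 4 = h * h ^ 3 by ring]
    gcongr
  have h1 := abs_le.1 h1
  have h2 := abs_le.1 h2
  rw [abs_le]
  constructor <;> nlinarith

/-- The cubic is odd about the midpoint of the cell; its antiderivative s²(s - h)²/4 vanishes at
both ends. -/
theorem integral_nodal_cubic (h α : ℝ) :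
    ∫ s in (0 : ℝ)..h, α * (s * (s - h / 2) * (s - h)) = 0 := by
  have : ∀ s ∈ uIcc 0 h, HasDerivAt (fun s => α * (s ^ 2 * (s - h) ^ 2 / 4))
      (α * (s * (s - h / 2) * (s - h))) s := by
    intro s _
    have := ((((hasDerivAt_id s).pow 2).mul (((hasDerivAt_id s).sub_const h).pow 2)).div_const
      4).const_mul α
    refine this.congr_deriv ?_
    change α * ((((2 : ℕ) : ℝ) * s ^ 1 * 1 * (s - h) ^ 2 + s ^ 2 * (((2 : ℕ) : ℝ) * (s - h) ^ 1 * 1))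
      / 4) = _
    push_cast
    ring
  rw [intervalIntegral.integral_eq_sub_of_hasDerivAt this
    (Continuous.intervalIntegrable (by fun_prop) _ _)]
  simp

theorem HasCubicExpansion.abs_integral_cell_le {a b B : ℝ} {v : ℝ → ℝ} {M m : ℕ}
    (hv : HasCubicExpansion a b B v) (hvc : ContinuousOn v (Icc a b)) (hab : a < b) (hM : 1 ≤ M)
    (hm : m < M) :
    |∫ x in cellLeft a b M m..cellLeft a b M (m + 1), interpErr a b M v x|
      ≤ 4 * B * meshSize a b M ^ 4 * meshSize a b M := by
  have hh := meshSize_pos hab hM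
  obtain ⟨α, hα, hE⟩ := hv.interpErr_cell hab hM hm
  have hend := (cellLeft_mem_Icc hab hM (Nat.succ_le_of_lt hm)).2
  have hstart := (cellLeft_mem_Icc hab hM hm.le).1
  rw [Nat.succ_eq_add_one, cellLeft_succ] at hend
  rw [cellLeft_succ]
  set h := meshSize a b M
  set p := cellLeft a b M m
  have hcont : ContinuousOn (fun s => interpErr a b M v (p + s)) (uIcc 0 h) := by
    refine (continuousOn_interpErr hab hM hvc).comp (by fun_prop) fun s hs => ?_
    rw [uIcc_of_le hh.le] at hs
    exact ⟨by linarith [hs.1], by linarith [hs.2]⟩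
  have h1 : ∫ x in p..p + h, interpErr a b M v x
      = ∫ s in (0 : ℝ)..h, (interpErr a b M v (p + s) - α * (s * (s - h / 2) * (s - h))) := by
    rw [intervalIntegral.integral_sub hcont.intervalIntegrable
      (Continuous.intervalIntegrable (by fun_prop) _ _), integral_nodal_cubic, sub_zero,
      intervalIntegral.integral_comp_add_left, add_zero]
  rw [h1]
  have h2 := intervalIntegral.norm_integral_le_of_norm_le_const (a := 0) (b := h)
    (C := 4 * B * h ^ 4)
    (f := fun s => interpErr a b M v (p + s) - α * (s * (s - h / 2) * (s - h))) fun s hs => by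
      rw [uIoc_of_le hh.le] at hs
      exact hE s ⟨hs.1.le, hs.2⟩
  rwa [sub_zero, abs_of_pos hh, Real.norm_eq_abs] at h2

/-- Complete cells contribute O(h⁵) each, and there are at most (b - a)/h of them. The one
incomplete cell has no cancellation, but its length supplies the missing power of h. -/
theorem HasCubicExpansion.abs_integral_le {a b B : ℝ} {v : ℝ → ℝ} {M : ℕ}
    (hv : HasCubicExpansion a b B v) (hvc : ContinuousOn v (Icc a b)) (hab : a < b) (hM : 1 ≤ M)
    {x : ℝ} (hx : x ∈ Icc a b) :
    |∫ s in a..x, interpErr a b M v s| ≤ B * (1 + 8 * (b - a)) * meshSize a b M ^ 4 := by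
  have hh := meshSize_pos hab hM
  have hMh := mul_meshSize (a := a) (b := b) hM
  obtain ⟨m, hm, hxm⟩ := exists_mem_cell hab hM hx
  have hB : 0 ≤ B := by
    obtain ⟨_, _, _, _, hc, _⟩ := hv _ hx
    exact (abs_nonneg _).trans hc
  have hint : ∀ p ∈ Icc a b, ∀ q ∈ Icc a b,
      IntervalIntegrable (interpErr a b M v) volume p q := fun p hp q hq =>
    ((continuousOn_interpErr hab hM hvc).mono (uIcc_subset_Icc hp hq)).intervalIntegrable
  have hp : cellLeft a b M m ∈ Icc a b := cellLeft_mem_Icc hab hM hm.le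
  have ha : a ∈ Icc a b := left_mem_Icc.2 hab.le
  have h0 : cellLeft a b M 0 = a := by simp [cellLeft]
  have hcells : |∫ s in a..cellLeft a b M m, interpErr a b M v s|
      ≤ m * (4 * B * meshSize a b M ^ 4 * meshSize a b M) := by
    have h1 := intervalIntegral.sum_integral_adjacent_intervals (f := interpErr a b M v)
      (μ := volume) (a := cellLeft a b M) (n := m) fun k hk =>
        hint _ (cellLeft_mem_Icc hab hM (by omega)) _ (cellLeft_mem_Icc hab hM (by omega))
    rw [h0] at h1
    rw [← h1]
    refine (Finset.abs_sum_le_sum_abs _ _).trans ?_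
    refine (Finset.sum_le_card_nsmul _ _ _ fun k hk =>
      hv.abs_integral_cell_le hvc hab hM ((Finset.mem_range.1 hk).trans hm)).trans ?_
    simp
  have hrest : |∫ s in cellLeft a b M m..x, interpErr a b M v s|
      ≤ B * (1 + 4 * (b - a)) * meshSize a b M ^ 3 * meshSize a b M := by
    have h1 := intervalIntegral.norm_integral_le_of_norm_le_const (a := cellLeft a b M m)
      (b := x) (f := interpErr a b M v) (C := B * (1 + 4 * (b - a)) * meshSize a b M ^ 3)
      fun s hs => hv.abs_interpErr_le hab hM (by
        rw [uIoc_of_le hxm.1] at hs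
        exact ⟨hp.1.trans hs.1.le, hs.2.trans hx.2⟩)
    refine h1.trans ?_
    have : 0 < b - a := sub_pos.2 hab
    rw [abs_of_nonneg (by linarith [hxm.1])]
    gcongr
    linarith [hxm.2]
  rw [← intervalIntegral.integral_add_adjacent_intervals (hint a ha _ hp) (hint _ hp x hx)]
  refine (abs_add_le _ _).trans ((add_le_add hcells hrest).trans ?_)
  have hmM : (m : ℝ) ≤ M := by exact_mod_cast hm.le
  have h2 : m * (4 * B * meshSize a b M ^ 4 * meshSize a b M)
      ≤ 4 * B * meshSize a b M ^ 4 * (b - a) := by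
    rw [← hMh]
    have : 0 ≤ 4 * B * meshSize a b M ^ 4 * meshSize a b M := by positivity
    nlinarith
  nlinarith

/-! ### The additive Cauchy kernel -/

/-- Valid at the origin too: for γ ≠ 0 both sides are 0 there by convention. -/
theorem one_div_delta (γ s t : ℝ) : 1 / delta γ s t = (s ^ 2 + t ^ 2) ^ (-(γ / 2)) := by
  unfold delta
  have h : 0 ≤ s ^ 2 + t ^ 2 := by positivity
  rw [abs_of_nonneg (Real.sqrt_nonneg _), Real.sqrt_eq_rpow, ← Real.rpow_mul h, one_div,
    ← Real.rpow_neg h]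
  congr 1
  ring

theorem delta_comm (γ s t : ℝ) : delta γ s t = delta γ t s := by
  unfold delta
  rw [add_comm]

theorem one_div_delta_nonneg (γ s t : ℝ) : 0 ≤ 1 / delta γ s t := by
  rw [one_div_delta]
  positivity

theorem measurable_one_div_delta (γ : ℝ) :
    Measurable fun q : ℝ × ℝ => 1 / delta γ q.1 q.2 := by
  simp only [one_div_delta]
  fun_prop

/-- Dropping t² makes the bound uniform in the transverse variable, which is what allows
one-dimensional estimates on each line. -/
theorem one_div_delta_le {γ h s : ℝ} (hγ : 0 < γ) (hh : 0 < h) (hs : h ≤ |s|) (t : ℝ) :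
    1 / delta γ s t ≤ h ^ (-γ) := by
  have h1 : h ^ 2 ≤ s ^ 2 + t ^ 2 := by
    nlinarith [sq_abs s, abs_nonneg s, sq_nonneg t]
  rw [one_div_delta]
  calc (s ^ 2 + t ^ 2) ^ (-(γ / 2)) ≤ (h ^ 2) ^ (-(γ / 2)) :=
        Real.rpow_le_rpow_of_nonpos (by positivity) h1 (by linarith)
    _ = h ^ (-γ) := by
        rw [← Real.rpow_natCast, ← Real.rpow_mul hh.le]
        congr 1
        push_cast
        ring

theorem one_div_delta_le_abs {γ s : ℝ} (hγ : 0 < γ) (hs : s ≠ 0) (t : ℝ) :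
    1 / delta γ s t ≤ |s| ^ (-γ) :=
  one_div_delta_le hγ (abs_pos.2 hs) le_rfl t

theorem hasDerivAt_one_div_delta {γ z x : ℝ} (hx : x ≠ z) (t : ℝ) :
    HasDerivAt (fun x => 1 / delta γ (z - x) t)
      (γ * (z - x) * ((z - x) ^ 2 + t ^ 2) ^ (-(γ / 2) - 1)) x := by
  simp only [one_div_delta]
  have hpos : (0 : ℝ) < (z - x) ^ 2 + t ^ 2 := by
    have : 0 < (z - x) ^ 2 := by
      have : z - x ≠ 0 := sub_ne_zero.2 hx.symm
      positivity
    positivity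
  have h1 : HasDerivAt (fun x => (z - x) ^ 2 + t ^ 2) (-2 * (z - x)) x := by
    refine ((((hasDerivAt_id x).const_sub z).pow 2).add_const (t ^ 2)).congr_deriv ?_
    change ((2 : ℕ) : ℝ) * (z - x) ^ 1 * (-1) = _
    push_cast
    ring
  refine (h1.rpow_const (p := -(γ / 2)) (Or.inl hpos.ne')).congr_deriv ?_
  ring

theorem intervalIntegrable_abs_sub_rpow {γ : ℝ} (hγ : γ < 1) (p q z : ℝ) :
    IntervalIntegrable (fun x => |x - z| ^ (-γ)) volume p q := by
  have h0 : ∀ r, IntervalIntegrable (fun x => |x| ^ (-γ)) volume 0 r := by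
    intro r
    rcases le_total 0 r with hr | hr
    · refine (intervalIntegral.intervalIntegrable_rpow' (r := -γ) (by linarith)).congr
        fun x hx => ?_
      rw [uIoc_of_le hr] at hx
      simp only [abs_of_pos hx.1]
    · have := (intervalIntegral.intervalIntegrable_rpow' (a := 0) (b := -r) (r := -γ)
        (by linarith)).comp_sub_left 0
      simp only [sub_zero, zero_sub, neg_neg] at this
      refine this.congr fun x hx => ?_
      rw [uIoc_of_ge hr] at hx
      simp only [abs_of_nonpos hx.2]
  have := (((h0 (p - z)).symm.trans (h0 (q - z))).comp_sub_right z)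
  simpa using this

theorem integral_abs_sub_rpow {γ p q z : ℝ} (hγ : γ < 1) (hp : p ≤ z) (hq : z ≤ q) :
    ∫ x in p..q, |x - z| ^ (-γ) = ((z - p) ^ (1 - γ) + (q - z) ^ (1 - γ)) / (1 - γ) := by
  have hI := intervalIntegrable_abs_sub_rpow hγ
  have h1 : ∫ x in z..q, |x - z| ^ (-γ) = (q - z) ^ (1 - γ) / (1 - γ) := by
    have e : ∫ x in z..q, |x - z| ^ (-γ) = ∫ x in z..q, (x - z) ^ (-γ) :=
      intervalIntegral.integral_congr fun x hx => by
        rw [uIcc_of_le hq] at hx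
        simp only [abs_of_nonneg (sub_nonneg.2 hx.1)]
    rw [e, intervalIntegral.integral_comp_sub_right (fun x => x ^ (-γ)),
      integral_rpow (Or.inl (by linarith)), sub_self, show -γ + 1 = 1 - γ by ring,
      Real.zero_rpow (by linarith), sub_zero]
  have h2 : ∫ x in p..z, |x - z| ^ (-γ) = (z - p) ^ (1 - γ) / (1 - γ) := by
    have e : ∫ x in p..z, |x - z| ^ (-γ) = ∫ x in p..z, (z - x) ^ (-γ) :=
      intervalIntegral.integral_congr fun x hx => by
        rw [uIcc_of_le hp] at hx
        simp only [abs_of_nonpos (sub_nonpos.2 hx.2), neg_sub]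
    rw [e, intervalIntegral.integral_comp_sub_left (fun x => x ^ (-γ)),
      integral_rpow (Or.inl (by linarith)), sub_self, show -γ + 1 = 1 - γ by ring,
      Real.zero_rpow (by linarith), sub_zero]
  rw [← intervalIntegral.integral_add_adjacent_intervals (hI p z z) (hI z q z), h1, h2]
  ring

theorem intervalIntegrable_one_div_delta {γ : ℝ} (hγ0 : 0 < γ) (hγ1 : γ < 1) (z t p q : ℝ) :
    IntervalIntegrable (fun x => 1 / delta γ (z - x) t) volume p q := by
  refine (intervalIntegrable_abs_sub_rpow hγ1 p q z).mono_fun ?_ ?_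
  · exact ((measurable_one_div_delta γ).comp
      (f := fun x : ℝ => (z - x, t)) (by fun_prop)).aestronglyMeasurable
  · have : ∀ᵐ x : ℝ, x ≠ z := by simp [ae_iff]
    filter_upwards [ae_restrict_of_ae this] with x hx
    rw [Real.norm_of_nonneg (one_div_delta_nonneg _ _ _), Real.norm_of_nonneg (by positivity),
      abs_sub_comm]
    exact one_div_delta_le_abs hγ0 (sub_ne_zero.2 hx.symm) t

/-- A bound in the spirit of the second mean value theorem, for a monotone weight. -/
theorem abs_integral_mul_le_of_primitive {p q η κ σ : ℝ} (hpq : p ≤ q) {E K K' : ℝ → ℝ}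
    (hE : ContinuousOn E (Icc p q)) (hη : ∀ x ∈ Icc p q, |∫ s in p..x, E s| ≤ η)
    (hK : ∀ x ∈ Icc p q, HasDerivAt K (K' x) x) (hK' : ContinuousOn K' (Icc p q))
    (hσ : |σ| = 1) (hsign : ∀ x ∈ Icc p q, 0 ≤ σ * K' x) (hκ : ∀ x ∈ Icc p q, |K x| ≤ κ) :
    |∫ x in p..q, K x * E x| ≤ 3 * η * κ := by
  have hE' : IntervalIntegrable E volume p q := hE.intervalIntegrable_of_Icc hpq
  have hK'i : IntervalIntegrable K' volume p q := hK'.intervalIntegrable_of_Icc hpq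
  have hp : p ∈ Icc p q := left_mem_Icc.2 hpq
  have hq : q ∈ Icc p q := right_mem_Icc.2 hpq
  have hη0 : 0 ≤ η := (abs_nonneg _).trans (hη p hp)
  have hκ0 : 0 ≤ κ := (abs_nonneg _).trans (hκ p hp)
  -- Integration by parts against the primitive of `E`, which is small although `E` itself need not
  -- be.
  have hparts := intervalIntegral.integral_mul_deriv_eq_deriv_mul_of_hasDeriv_right
    (a := p) (b := q) (u := K) (u' := K') (v := fun x => ∫ s in p..x, E s) (v' := E)
    (by
      rw [uIcc_of_le hpq]
      exact fun x hx => (hK x hx).continuousAt.continuousWithinAt)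
    (intervalIntegral.continuousOn_primitive_interval' hE' left_mem_uIcc)
    (fun x hx => by
      rw [min_eq_left hpq, max_eq_right hpq] at hx
      exact (hK x (Ioo_subset_Icc_self hx)).hasDerivWithinAt)
    (fun x hx => by
      rw [min_eq_left hpq, max_eq_right hpq] at hx
      have hx' := Ioo_subset_Icc_self hx
      refine (intervalIntegral.integral_hasDerivAt_right
        ((hE.mono (Icc_subset_Icc_right hx'.2)).intervalIntegrable_of_Icc hx'.1) ?_
        (hE.continuousAt (Icc_mem_nhds hx.1 hx.2))).hasDerivWithinAt
      exact (hE.mono Ioo_subset_Icc_self).stronglyMeasurableAtFilter isOpen_Ioo x hx)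
    hK'i hE'
  rw [hparts, intervalIntegral.integral_same, mul_zero, sub_zero]
  have h1 : |K q * ∫ s in p..q, E s| ≤ κ * η := by
    rw [abs_mul]
    exact mul_le_mul (hκ q hq) (hη q hq) (abs_nonneg _) hκ0
  have h2 : |∫ x in p..q, K' x * ∫ s in p..x, E s| ≤ ∫ x in p..q, η * (σ * K' x) := by
    rw [← Real.norm_eq_abs]
    refine intervalIntegral.norm_integral_le_of_norm_le hpq ?_ ((hK'i.const_mul σ).const_mul η)
    refine Filter.Eventually.of_forall fun x hx => ?_
    have hx' := Ioc_subset_Icc_self hx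
    have : |K' x| = σ * K' x := by
      rw [← one_mul |K' x|, ← hσ, ← abs_mul, abs_of_nonneg (hsign x hx')]
    rw [Real.norm_eq_abs, abs_mul, this, mul_comm]
    exact mul_le_mul_of_nonneg_right (hη x hx') (hsign x hx')
  -- Since `K'` has constant sign, its L¹ norm is |K q - K p| ≤ 2κ; the boundary term adds one more
  -- κ.
  have h3 : ∫ x in p..q, η * (σ * K' x) ≤ η * (2 * κ) := by
    rw [intervalIntegral.integral_const_mul, intervalIntegral.integral_const_mul,
      intervalIntegral.integral_eq_sub_of_hasDerivAt
        (fun x hx => hK x (by rwa [uIcc_of_le hpq] at hx)) hK'i]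
    refine mul_le_mul_of_nonneg_left ?_ hη0
    refine (le_abs_self _).trans ?_
    rw [abs_mul, hσ, one_mul]
    refine (abs_sub _ _).trans ?_
    linarith [hκ p hp, hκ q hq]
  refine (abs_sub _ _).trans ?_
  linarith

/-- Integration against the kernel gains the order `1 - γ` over the pointwise bound, if the
primitive is one order smaller than the function. -/
theorem abs_integral_mul_kernel_le {γ a b h C z : ℝ} (hγ0 : 0 < γ) (hγ1 : γ < 1) (hh : 0 < h)
    (hz : z ∈ Icc a b) {E : ℝ → ℝ} (hE : ContinuousOn E (Icc a b))
    (hE1 : ∀ x ∈ Icc a b, |E x| ≤ C * h ^ 3)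
    (hE2 : ∀ x ∈ Icc a b, |∫ s in a..x, E s| ≤ C * h ^ 4) (t : ℝ) :
    |∫ x in a..b, 1 / delta γ (z - x) t * E x| ≤ C * (2 / (1 - γ) + 9) * h ^ (4 - γ) := by
  have hab : a ≤ b := hz.1.trans hz.2
  have hC : 0 ≤ C := by
    have := (abs_nonneg _).trans (hE1 z hz)
    by_contra! hC
    have : C * h ^ 3 < 0 := mul_neg_of_neg_of_pos hC (by positivity)
    linarith
  have hpow3 : h ^ 3 * h ^ (1 - γ) = h ^ (4 - γ) := by
    rw [← Real.rpow_natCast, ← Real.rpow_add hh]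
    congr 1
    push_cast
    ring
  have hpow4 : h ^ 4 * h ^ (-γ) = h ^ (4 - γ) := by
    rw [← Real.rpow_natCast, ← Real.rpow_add hh]
    congr 1
  -- The interval is cut at distance `h` from the singularity, with the cuts clipped to the interval
  -- when `z` is near an end.
  set p := max a (z - h) with hp_def
  set q := min b (z + h) with hq_def
  have hap : a ≤ p := le_max_left _ _
  have hpz : p ≤ z := max_le hz.1 (by linarith)
  have hzq : z ≤ q := le_min hz.2 (by linarith)
  have hqb : q ≤ b := min_le_left _ _
  have hp1 : z - p ≤ h := by linarith [le_max_right a (z - h)]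
  have hq1 : q - z ≤ h := by linarith [min_le_right b (z + h)]
  have hEi : ∀ r ∈ Icc a b, ∀ s ∈ Icc a b, IntervalIntegrable E volume r s := fun r hr s hs =>
    (hE.mono (uIcc_subset_Icc hr hs)).intervalIntegrable
  have hI : ∀ r ∈ Icc a b, ∀ s ∈ Icc a b,
      IntervalIntegrable (fun x => 1 / delta γ (z - x) t * E x) volume r s := fun r hr s hs =>
    (intervalIntegrable_one_div_delta hγ0 hγ1 z t r s).mul_continuousOn
      (hE.mono (uIcc_subset_Icc hr hs))
  have ha : a ∈ Icc a b := left_mem_Icc.2 hab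
  have hb : b ∈ Icc a b := right_mem_Icc.2 hab
  have hp : p ∈ Icc a b := ⟨hap, hpz.trans hz.2⟩
  have hq : q ∈ Icc a b := ⟨hz.1.trans hzq, hqb⟩
  have hK'c : ∀ S : Set ℝ, (∀ x ∈ S, x ≠ z) → ContinuousOn
      (fun x => γ * (z - x) * ((z - x) ^ 2 + t ^ 2) ^ (-(γ / 2) - 1)) S := by
    intro S hS
    refine ContinuousOn.mul (by fun_prop) (ContinuousOn.rpow_const (by fun_prop) ?_)
    intro x hx
    left
    have : z - x ≠ 0 := sub_ne_zero.2 (hS x hx).symm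
    positivity
  have hleft : |∫ x in a..p, 1 / delta γ (z - x) t * E x| ≤ 3 * (C * h ^ 4) * h ^ (-γ) := by
    rcases le_total (z - h) a with hc | hc
    · rw [hp_def, max_eq_left hc, intervalIntegral.integral_same, abs_zero]
      positivity
    · have hpe : p = z - h := max_eq_right hc
      refine abs_integral_mul_le_of_primitive (σ := 1) hap (hE.mono (Icc_subset_Icc_right hp.2))
        (fun x hx => hE2 x ⟨hx.1, hx.2.trans hp.2⟩)
        (fun x hx => hasDerivAt_one_div_delta (by linarith [hx.2]) t)
        (hK'c _ fun x hx => by linarith [hx.2]) (by norm_num) ?_ ?_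
      · intro x hx
        have : 0 ≤ z - x := by linarith [hx.2]
        positivity
      · intro x hx
        rw [abs_of_nonneg (one_div_delta_nonneg _ _ _)]
        exact one_div_delta_le hγ0 hh ((by linarith [hx.2] : h ≤ z - x).trans (le_abs_self _)) t
  -- Here the primitive has to start at `q`. It is a difference of two primitives from `a`, which
  -- doubles the bound; 3 + 6 gives the 9 in the statement.
  have hright : |∫ x in q..b, 1 / delta γ (z - x) t * E x|
      ≤ 3 * (2 * (C * h ^ 4)) * h ^ (-γ) := by
    rcases le_total b (z + h) with hc | hc
    · rw [hq_def, min_eq_left hc, intervalIntegral.integral_same, abs_zero]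
      positivity
    · have hqe : q = z + h := min_eq_right hc
      refine abs_integral_mul_le_of_primitive (σ := -1) hqb (hE.mono (Icc_subset_Icc_left hq.1))
        ?_ (fun x hx => hasDerivAt_one_div_delta (by linarith [hx.1]) t)
        (hK'c _ fun x hx => by linarith [hx.1]) (by norm_num) ?_ ?_
      · intro x hx
        have hx' : x ∈ Icc a b := ⟨hq.1.trans hx.1, hx.2⟩
        rw [← intervalIntegral.integral_interval_sub_left (hEi a ha x hx') (hEi a ha q hq)]
        refine (abs_sub _ _).trans ?_
        linarith [hE2 x hx', hE2 q hq]
      · intro x hx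
        have h1 : 0 ≤ x - z := by linarith [hx.1]
        have h2 : 0 ≤ γ * (x - z) * ((z - x) ^ 2 + t ^ 2) ^ (-(γ / 2) - 1) := by positivity
        linarith
      · intro x hx
        rw [abs_of_nonneg (one_div_delta_nonneg _ _ _)]
        refine one_div_delta_le hγ0 hh ?_ t
        rw [abs_sub_comm]
        exact (by linarith [hx.1] : h ≤ x - z).trans (le_abs_self _)
  -- Near the singularity there is no cancellation to use: the pointwise bound is multiplied by the
  -- integral of the majorant |x - z|^(-γ).
  have hmid : |∫ x in p..q, 1 / delta γ (z - x) t * E x|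
      ≤ C * h ^ 3 * (2 / (1 - γ) * h ^ (1 - γ)) := by
    have h1 : |∫ x in p..q, 1 / delta γ (z - x) t * E x|
        ≤ ∫ x in p..q, C * h ^ 3 * |x - z| ^ (-γ) := by
      rw [← Real.norm_eq_abs]
      refine intervalIntegral.norm_integral_le_of_norm_le (hpz.trans hzq) ?_
        ((intervalIntegrable_abs_sub_rpow hγ1 p q z).const_mul _)
      have : ∀ᵐ x : ℝ, x ≠ z := by simp [ae_iff]
      filter_upwards [this] with x hx hxm
      rw [Real.norm_eq_abs, abs_mul, abs_of_nonneg (one_div_delta_nonneg _ _ _), mul_comm,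
        abs_sub_comm]
      exact mul_le_mul (hE1 x ⟨hap.trans hxm.1.le, hxm.2.trans hqb⟩)
        (one_div_delta_le_abs hγ0 (sub_ne_zero.2 hx.symm) t) (one_div_delta_nonneg _ _ _)
        (by positivity)
    refine h1.trans ?_
    rw [intervalIntegral.integral_const_mul, integral_abs_sub_rpow hγ1 hpz hzq]
    have hγ' : 0 < 1 - γ := by linarith
    refine mul_le_mul_of_nonneg_left ?_ (by positivity)
    rw [div_mul_eq_mul_div, two_mul]
    gcongr
  rw [← intervalIntegral.integral_add_adjacent_intervals (hI a ha q hq) (hI q hq b hb),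
    ← intervalIntegral.integral_add_adjacent_intervals (hI a ha p hp) (hI p hp q hq)]
  refine (abs_add_le _ _).trans ((add_le_add_left (abs_add_le _ _) _).trans ?_)
  have e1 : 3 * (C * h ^ 4) * h ^ (-γ) = 3 * C * h ^ (4 - γ) := by rw [← hpow4]; ring
  have e2 : 3 * (2 * (C * h ^ 4)) * h ^ (-γ) = 6 * C * h ^ (4 - γ) := by rw [← hpow4]; ring
  have e3 : C * h ^ 3 * (2 / (1 - γ) * h ^ (1 - γ)) = C * (2 / (1 - γ)) * h ^ (4 - γ) := by
    rw [← hpow3]; ring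
  rw [e1] at hleft
  rw [e2] at hright
  rw [e3] at hmid
  linarith

/-! ### Integrals over the rectangle -/

theorem volume_restrict_Omega (a b c d : ℝ) :
    (volume : Measure (ℝ × ℝ)).restrict (Omega a b c d)
      = (volume.restrict (Ioo a b)).prod (volume.restrict (Ioo c d)) := by
  rw [Omega, Measure.volume_eq_prod, Measure.prod_restrict]

theorem measurableSet_Omega (a b c d : ℝ) : MeasurableSet (Omega a b c d) :=
  measurableSet_Ioo.prod measurableSet_Ioo

theorem integrableOn_abs_rpow_snd {γ : ℝ} (hγ : γ < 1) (a b c d y : ℝ) :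
    IntegrableOn (fun q : ℝ × ℝ => |q.2 - y| ^ (-γ)) (Omega a b c d) := by
  have h1 : IntegrableOn (fun s : ℝ => |s - y| ^ (-γ)) (Ioo c d) := by
    rcases le_total c d with h | h
    · exact ((intervalIntegrable_iff_integrableOn_Ioo_of_le h).1
        (intervalIntegrable_abs_sub_rpow hγ c d y))
    · rw [Ioo_eq_empty (not_lt.2 h)]
      exact integrableOn_empty
  have h2 : IntegrableOn (fun _ : ℝ => (1 : ℝ)) (Ioo a b) := integrableOn_const (by simp)
  have h3 := Integrable.mul_prod h2 h1
  simp only [one_mul] at h3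
  rwa [IntegrableOn, volume_restrict_Omega]

theorem ae_one_div_delta_le {γ : ℝ} (hγ : 0 < γ) (x y : ℝ) :
    ∀ᵐ q : ℝ × ℝ, 1 / delta γ (x - q.1) (y - q.2) ≤ |q.2 - y| ^ (-γ) := by
  have h0 : ∀ᵐ s : ℝ, s ≠ y := by simp [ae_iff]
  have h1 : ∀ᵐ q : ℝ × ℝ, q.2 ≠ y := by
    rw [Measure.volume_eq_prod]
    exact Measure.quasiMeasurePreserving_snd.ae h0
  filter_upwards [h1] with q hq
  rw [delta_comm, abs_sub_comm]
  exact one_div_delta_le_abs hγ (sub_ne_zero.2 hq.symm) _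

theorem integrableOn_one_div_delta {γ : ℝ} (hγ0 : 0 < γ) (hγ1 : γ < 1) (a b c d x y : ℝ) :
    IntegrableOn (fun q : ℝ × ℝ => 1 / delta γ (x - q.1) (y - q.2)) (Omega a b c d) := by
  refine (integrableOn_abs_rpow_snd hγ1 a b c d y).mono' ?_ ?_
  · exact ((measurable_one_div_delta γ).comp
      (f := fun q : ℝ × ℝ => (x - q.1, y - q.2)) (by fun_prop)).aestronglyMeasurable
  · filter_upwards [ae_restrict_of_ae (ae_one_div_delta_le hγ0 x y)] with q hq
    rwa [Real.norm_of_nonneg (one_div_delta_nonneg _ _ _)]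

/-- The kernel is majorized by a function of the second coordinate alone. The first coordinate then
contributes its full length, whence the asymmetry of `constCd` in the two sides. -/
theorem integral_one_div_delta_le {γ a b c d y : ℝ} (hγ0 : 0 < γ) (hγ1 : γ < 1) (hab : a < b)
    (hy : y ∈ Icc c d) (x : ℝ) :
    ∫ q in Omega a b c d, 1 / delta γ (x - q.1) (y - q.2) ≤ constCd γ a b c d := by
  have hcd : c ≤ d := hy.1.trans hy.2
  have h1 : ∫ q in Omega a b c d, 1 / delta γ (x - q.1) (y - q.2)
      ≤ ∫ q in Omega a b c d, |q.2 - y| ^ (-γ) :=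
    integral_mono_ae (integrableOn_one_div_delta hγ0 hγ1 a b c d x y)
      (integrableOn_abs_rpow_snd hγ1 a b c d y)
      (ae_restrict_of_ae (ae_one_div_delta_le hγ0 x y))
  refine h1.trans ?_
  have h2 : ∫ q in Omega a b c d, |q.2 - y| ^ (-γ)
      = (b - a) * ∫ s in c..d, |s - y| ^ (-γ) := by
    rw [volume_restrict_Omega]
    have := integral_prod_mul (μ := (volume : Measure ℝ).restrict (Ioo a b))
      (ν := (volume : Measure ℝ).restrict (Ioo c d)) (fun _ : ℝ => (1 : ℝ))
      (fun s : ℝ => |s - y| ^ (-γ))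
    simp only [one_mul] at this
    rw [this, intervalIntegral.integral_of_le hcd, integral_Ioc_eq_integral_Ioo]
    simp [hab.le]
  rw [h2, integral_abs_sub_rpow hγ1 hy.1 hy.2, constCd]
  have hγ' : 0 < 1 - γ := by linarith
  have hba : 0 < b - a := by linarith
  have h3 : (y - c) ^ (1 - γ) ≤ (d - c) ^ (1 - γ) :=
    Real.rpow_le_rpow (by linarith [hy.1]) (by linarith [hy.2]) hγ'.le
  have h4 : (d - y) ^ (1 - γ) ≤ (d - c) ^ (1 - γ) :=
    Real.rpow_le_rpow (by linarith [hy.2]) (by linarith [hy.1]) hγ'.le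
  rw [mul_div_assoc', div_le_div_iff_of_pos_right hγ']
  nlinarith

theorem integrableOn_div_delta {γ a b c d K : ℝ} (hγ0 : 0 < γ) (hγ1 : γ < 1) (x y : ℝ)
    {F : ℝ × ℝ → ℝ} (hF : ContinuousOn F (Icc a b ×ˢ Icc c d))
    (hK : ∀ q ∈ Icc a b ×ˢ Icc c d, |F q| ≤ K) :
    IntegrableOn (fun q => F q / delta γ (x - q.1) (y - q.2)) (Omega a b c d) := by
  have hsub : Omega a b c d ⊆ Icc a b ×ˢ Icc c d :=
    prod_mono Ioo_subset_Icc_self Ioo_subset_Icc_self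
  simp only [div_eq_mul_one_div (F _)]
  refine Integrable.bdd_mul (c := K) (integrableOn_one_div_delta hγ0 hγ1 a b c d x y) ?_ ?_
  · exact (hF.mono hsub).aestronglyMeasurable (measurableSet_Omega a b c d)
  · filter_upwards [ae_restrict_mem (measurableSet_Omega a b c d)] with q hq
    exact hK q (hsub hq)

theorem abs_integral_div_delta_le {γ a b c d K : ℝ} (hγ0 : 0 < γ) (hγ1 : γ < 1) (hab : a < b)
    {y : ℝ} (hy : y ∈ Icc c d) (x : ℝ) {F : ℝ × ℝ → ℝ}
    (hK : ∀ q ∈ Icc a b ×ˢ Icc c d, |F q| ≤ K) :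
    |∫ q in Omega a b c d, F q / delta γ (x - q.1) (y - q.2)| ≤ K * constCd γ a b c d := by
  have hsub : Omega a b c d ⊆ Icc a b ×ˢ Icc c d :=
    prod_mono Ioo_subset_Icc_self Ioo_subset_Icc_self
  have hK0 : 0 ≤ K := (abs_nonneg _).trans (hK (a, y) ⟨left_mem_Icc.2 hab.le, hy⟩)
  rw [← Real.norm_eq_abs]
  refine (norm_integral_le_of_norm_le
    ((integrableOn_one_div_delta hγ0 hγ1 a b c d x y).const_mul K) ?_).trans ?_
  · filter_upwards [ae_restrict_mem (measurableSet_Omega a b c d)] with q hq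
    rw [div_eq_mul_one_div, norm_mul, Real.norm_of_nonneg (one_div_delta_nonneg _ _ _)]
    exact mul_le_mul_of_nonneg_right (hK q (hsub hq)) (one_div_delta_nonneg _ _ _)
  · rw [integral_const_mul]
    exact mul_le_mul_of_nonneg_left (integral_one_div_delta_le hγ0 hγ1 hab hy x) hK0

/-! ### The spatial consistency error -/

theorem integrableOn_div_delta_of_continuousOn {γ a b c d : ℝ} (hγ0 : 0 < γ) (hγ1 : γ < 1)
    (x y : ℝ) {F : ℝ × ℝ → ℝ} (hF : ContinuousOn F (Icc a b ×ˢ Icc c d)) :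
    IntegrableOn (fun q => F q / delta γ (x - q.1) (y - q.2)) (Omega a b c d) := by
  obtain ⟨K, hK⟩ := (isCompact_Icc.prod isCompact_Icc).exists_bound_of_continuousOn hF
  exact integrableOn_div_delta hγ0 hγ1 x y hF hK

/-- Fubini with the interpolated coordinate innermost; the other enters the kernel as a parameter
and costs only its side length. -/
theorem abs_integral_Omega_le_of_inner_fst {γ a b c d K : ℝ} (hγ0 : 0 < γ) (hγ1 : γ < 1)
    (hab : a ≤ b) (hcd : c ≤ d) (x y : ℝ) {F : ℝ × ℝ → ℝ}
    (hF : ContinuousOn F (Icc a b ×ˢ Icc c d))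
    (hK : ∀ s ∈ Icc c d, |∫ r in a..b, 1 / delta γ (x - r) (y - s) * F (r, s)| ≤ K) :
    |∫ q in Omega a b c d, F q / delta γ (x - q.1) (y - q.2)| ≤ K * (d - c) := by
  have hint := integrableOn_div_delta_of_continuousOn hγ0 hγ1 x y hF
  rw [IntegrableOn, volume_restrict_Omega] at hint
  rw [volume_restrict_Omega, integral_prod_symm _ hint]
  have h := norm_setIntegral_le_of_norm_le_const (μ := volume) (s := Ioo c d) (C := K)
    (f := fun s => ∫ r in Ioo a b, F (r, s) / delta γ (x - r) (y - s)) (by simp) fun s hs => by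
      have := hK s (Ioo_subset_Icc_self hs)
      rw [intervalIntegral.integral_of_le hab, integral_Ioc_eq_integral_Ioo] at this
      simpa only [one_div_mul_eq_div, Real.norm_eq_abs] using this
  simpa [hcd] using h

theorem abs_integral_Omega_le_of_inner_snd {γ a b c d K : ℝ} (hγ0 : 0 < γ) (hγ1 : γ < 1)
    (hab : a ≤ b) (hcd : c ≤ d) (x y : ℝ) {F : ℝ × ℝ → ℝ}
    (hF : ContinuousOn F (Icc a b ×ˢ Icc c d))
    (hK : ∀ r ∈ Icc a b, |∫ s in c..d, 1 / delta γ (y - s) (x - r) * F (r, s)| ≤ K) :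
    |∫ q in Omega a b c d, F q / delta γ (x - q.1) (y - q.2)| ≤ K * (b - a) := by
  have hint := integrableOn_div_delta_of_continuousOn hγ0 hγ1 x y hF
  rw [IntegrableOn, volume_restrict_Omega] at hint
  rw [volume_restrict_Omega, integral_prod _ hint]
  have h := norm_setIntegral_le_of_norm_le_const (μ := volume) (s := Ioo a b) (C := K)
    (f := fun r => ∫ s in Ioo c d, F (r, s) / delta γ (x - r) (y - s)) (by simp) fun r hr => by
      have := hK r (Ioo_subset_Icc_self hr)
      rw [intervalIntegral.integral_of_le hcd, integral_Ioc_eq_integral_Ioo] at this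
      simpa only [one_div_mul_eq_div, delta_comm γ (y - _), Real.norm_eq_abs] using this
  simpa [hab] using h

/-- The tensor product of the basis functions, weighted by nodal values. -/
noncomputable def tensorSum (a b c d : ℝ) (Mx My : ℕ) (w : ℕ → ℕ → ℝ) (q : ℝ × ℝ) : ℝ :=
  ∑ l ∈ Finset.range (2 * Mx + 1), ∑ r ∈ Finset.range (2 * My + 1),
    basisFun a b Mx l q.1 * basisFun c d My r q.2 * w l r

/-- Constant of the one-dimensional superconvergence estimate. -/
noncomputable def interpConst (γ a b B : ℝ) : ℝ := B * (1 + 8 * (b - a)) * (2 / (1 - γ) + 9)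

theorem continuousOn_slice_fst {a b c d y : ℝ} {v : ℝ → ℝ → ℝ}
    (hv : ContinuousOn (fun q : ℝ × ℝ => v q.1 q.2) (Icc a b ×ˢ Icc c d)) (hy : y ∈ Icc c d) :
    ContinuousOn (fun x => v x y) (Icc a b) :=
  hv.comp (f := fun x => (x, y)) (by fun_prop) fun _ hx => ⟨hx, hy⟩

theorem continuousOn_slice_snd {a b c d x : ℝ} {v : ℝ → ℝ → ℝ}
    (hv : ContinuousOn (fun q : ℝ × ℝ => v q.1 q.2) (Icc a b ×ˢ Icc c d)) (hx : x ∈ Icc a b) :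
    ContinuousOn (v x) (Icc c d) :=
  hv.comp (f := fun y => (x, y)) (by fun_prop) fun _ hy => ⟨hx, hy⟩

theorem abs_integral_interpErr_fst_le {γ a b c d B x y : ℝ} {Mx : ℕ} (hγ0 : 0 < γ) (hγ1 : γ < 1)
    (hab : a < b) (hcd : c < d) (hMx : 1 ≤ Mx) {v : ℝ → ℝ → ℝ}
    (hv : ContinuousOn (fun q : ℝ × ℝ => v q.1 q.2) (Icc a b ×ˢ Icc c d))
    (hvx : ∀ y ∈ Icc c d, HasCubicExpansion a b B fun x => v x y) (hB : 0 ≤ B)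
    (hx : x ∈ Icc a b) :
    |∫ q in Omega a b c d, interpErr a b Mx (fun r => v r q.2) q.1 /
        delta γ (x - q.1) (y - q.2)|
      ≤ interpConst γ a b B * meshSize a b Mx ^ (4 - γ) * (d - c) := by
  have hh := meshSize_pos hab hMx
  refine abs_integral_Omega_le_of_inner_fst hγ0 hγ1 hab.le hcd.le x y
    (F := fun q => interpErr a b Mx (fun r => v r q.2) q.1) ?_ fun s hs => ?_
  · refine hv.sub (continuousOn_finsetSum _ fun l hl => ?_)
    refine ((continuous_basisFun hab hMx l).comp continuous_fst).continuousOn.mul ?_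
    exact (continuousOn_slice_snd hv (node_mem_Icc hab hMx
      (Nat.lt_succ_iff.1 (Finset.mem_range.1 hl)))).comp continuousOn_snd fun q hq => hq.2
  · have hs' := continuousOn_slice_fst hv hs
    refine abs_integral_mul_kernel_le (C := B * (1 + 8 * (b - a))) hγ0 hγ1 hh hx
      (continuousOn_interpErr hab hMx hs') (fun r hr => ?_)
      (fun r hr => (hvx s hs).abs_integral_le hs' hab hMx hr) _
    -- The constant 1 + 4(b - a) is enlarged to 1 + 8(b - a), so that the error and its primitive
    -- share one constant.
    refine ((hvx s hs).abs_interpErr_le hab hMx hr).trans ?_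
    have : 0 < b - a := sub_pos.2 hab
    gcongr
    norm_num

/-- For a fixed first coordinate the integrand is a combination of one-dimensional errors along mesh
lines, with weights independent of the integration variable. The bounds on the error and on its
primitive both survive with the factor 3. -/
theorem abs_integral_interp_interpErr_snd_le {γ a b c d B x y : ℝ} {Mx My : ℕ} (hγ0 : 0 < γ)
    (hγ1 : γ < 1) (hab : a < b) (hcd : c < d) (hMx : 1 ≤ Mx) (hMy : 1 ≤ My) {v : ℝ → ℝ → ℝ}
    (hv : ContinuousOn (fun q : ℝ × ℝ => v q.1 q.2) (Icc a b ×ˢ Icc c d))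
    (hvy : ∀ x ∈ Icc a b, HasCubicExpansion c d B (v x)) (hB : 0 ≤ B) (hy : y ∈ Icc c d) :
    |∫ q in Omega a b c d, interp a b Mx (fun r => interpErr c d My (v r) q.2) q.1 /
        delta γ (x - q.1) (y - q.2)|
      ≤ 3 * interpConst γ c d B * meshSize c d My ^ (4 - γ) * (b - a) := by
  have hh := meshSize_pos hcd hMy
  have hnode : ∀ l < 2 * Mx + 1, node a b Mx l ∈ Icc a b := fun l hl =>
    node_mem_Icc hab hMx (Nat.lt_succ_iff.1 hl)
  have hErr : ∀ l < 2 * Mx + 1, ContinuousOn (interpErr c d My (v (node a b Mx l))) (Icc c d) :=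
    fun l hl => continuousOn_interpErr hcd hMy (continuousOn_slice_snd hv (hnode l hl))
  refine abs_integral_Omega_le_of_inner_snd hγ0 hγ1 hab.le hcd.le x y
    (F := fun q => interp a b Mx (fun r => interpErr c d My (v r) q.2) q.1) ?_ fun r hr => ?_
  · refine continuousOn_finsetSum _ fun l hl => ?_
    refine ((continuous_basisFun hab hMx l).comp continuous_fst).continuousOn.mul ?_
    exact (hErr l (Finset.mem_range.1 hl)).comp continuousOn_snd fun q hq => hq.2
  · have hd : 0 < d - c := sub_pos.2 hcd
    have key := abs_integral_mul_kernel_le (C := 3 * (B * (1 + 8 * (d - c))))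
      (E := fun s => interp a b Mx (fun r => interpErr c d My (v r) s) r) hγ0 hγ1 hh hy
      (continuousOn_finsetSum _ fun l hl =>
        continuousOn_const.mul (hErr l (Finset.mem_range.1 hl)))
      (fun s hs => ?_) (fun s hs => ?_) (x - r)
    · refine key.trans (le_of_eq ?_)
      unfold interpConst
      ring
    · rw [mul_assoc 3]
      refine abs_sum_basisFun_mul_le hab hMx hr fun l hl => ?_
      refine ((hvy _ (hnode l hl)).abs_interpErr_le hcd hMy hs).trans ?_
      gcongr
      norm_num
    · unfold interp
      rw [intervalIntegral.integral_finsetSum]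
      · simp only [intervalIntegral.integral_const_mul]
        rw [mul_assoc 3]
        refine abs_sum_basisFun_mul_le hab hMx hr fun l hl => ?_
        exact (hvy _ (hnode l hl)).abs_integral_le (continuousOn_slice_snd hv (hnode l hl))
          hcd hMy hs
      · intro l hl
        refine IntervalIntegrable.const_mul ?_ _
        exact ((hErr l (Finset.mem_range.1 hl)).mono
          (uIcc_subset_Icc (left_mem_Icc.2 hcd.le) hs)).intervalIntegrable

/-- The splitting v - PQv = (v - Pv) + P(v - Qv), with P and Q the interpolations in the first and
second coordinate. -/
theorem sub_tensorSum_eq (a b c d : ℝ) (Mx My : ℕ) (v : ℝ → ℝ → ℝ) (q : ℝ × ℝ) :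
    v q.1 q.2 - tensorSum a b c d Mx My (fun l r => v (node a b Mx l) (node c d My r)) q
      = interpErr a b Mx (fun r => v r q.2) q.1
        + interp a b Mx (fun r => interpErr c d My (v r) q.2) q.1 := by
  unfold interpErr interp tensorSum
  simp only [mul_sub, Finset.sum_sub_distrib, Finset.mul_sum, mul_assoc]
  ring

theorem continuous_tensorSum {a b c d : ℝ} {Mx My : ℕ} (hab : a < b) (hcd : c < d)
    (hMx : 1 ≤ Mx) (hMy : 1 ≤ My) (w : ℕ → ℕ → ℝ) : Continuous (tensorSum a b c d Mx My w) := by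
  have h1 := continuous_basisFun hab hMx
  have h2 := continuous_basisFun hcd hMy
  unfold tensorSum
  fun_prop

/-- The consistency error of the collocation of the integral operator. -/
theorem abs_integral_sub_tensorSum_le {γ a b c d B x y : ℝ} {Mx My : ℕ} (hγ0 : 0 < γ)
    (hγ1 : γ < 1) (hab : a < b) (hcd : c < d) (hMx : 1 ≤ Mx) (hMy : 1 ≤ My) {v : ℝ → ℝ → ℝ}
    (hv : ContinuousOn (fun q : ℝ × ℝ => v q.1 q.2) (Icc a b ×ˢ Icc c d))
    (hvx : ∀ y ∈ Icc c d, HasCubicExpansion a b B fun x => v x y)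
    (hvy : ∀ x ∈ Icc a b, HasCubicExpansion c d B (v x)) (hB : 0 ≤ B)
    (hx : x ∈ Icc a b) (hy : y ∈ Icc c d) :
    |∫ q in Omega a b c d, (v q.1 q.2
        - tensorSum a b c d Mx My (fun l r => v (node a b Mx l) (node c d My r)) q) /
          delta γ (x - q.1) (y - q.2)|
      ≤ interpConst γ a b B * (d - c) * meshSize a b Mx ^ (4 - γ)
        + 3 * interpConst γ c d B * (b - a) * meshSize c d My ^ (4 - γ) := by
  have hc1 : ContinuousOn (fun q : ℝ × ℝ => interpErr a b Mx (fun r => v r q.2) q.1)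
      (Icc a b ×ˢ Icc c d) := by
    refine hv.sub (continuousOn_finsetSum _ fun l hl => ?_)
    refine ((continuous_basisFun hab hMx l).comp continuous_fst).continuousOn.mul ?_
    exact (continuousOn_slice_snd hv (node_mem_Icc hab hMx
      (Nat.lt_succ_iff.1 (Finset.mem_range.1 hl)))).comp continuousOn_snd fun q hq => hq.2
  have hc2 : ContinuousOn
      (fun q : ℝ × ℝ => interp a b Mx (fun r => interpErr c d My (v r) q.2) q.1)
      (Icc a b ×ˢ Icc c d) := by
    -- Continuity of the second summand is read off from the splitting.
    refine ((hv.sub (continuous_tensorSum hab hcd hMx hMy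
      fun l r => v (node a b Mx l) (node c d My r)).continuousOn).sub hc1).congr fun q _ => ?_
    have := sub_tensorSum_eq a b c d Mx My v q
    simp only [Pi.sub_apply]
    linarith
  simp only [sub_tensorSum_eq, add_div]
  rw [integral_add (integrableOn_div_delta_of_continuousOn hγ0 hγ1 x y hc1)
    (integrableOn_div_delta_of_continuousOn hγ0 hγ1 x y hc2)]
  refine (abs_add_le _ _).trans ((add_le_add
    (abs_integral_interpErr_fst_le hγ0 hγ1 hab hcd hMx hv hvx hB hx)
    (abs_integral_interp_interpErr_snd_le hγ0 hγ1 hab hcd hMx hMy hv hvy hB hy)).trans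
      (le_of_eq ?_))
  ring

/-! ### The collocation matrix -/

theorem integrableOn_basis_div_delta {γ a b c d : ℝ} {Mx My : ℕ} (hγ0 : 0 < γ) (hγ1 : γ < 1)
    (hab : a < b) (hcd : c < d) (hMx : 1 ≤ Mx) (hMy : 1 ≤ My) (x y : ℝ) (l r : ℕ) :
    IntegrableOn (fun q : ℝ × ℝ => basisFun a b Mx l q.1 * basisFun c d My r q.2 /
      delta γ (x - q.1) (y - q.2)) (Omega a b c d) :=
  integrableOn_div_delta_of_continuousOn hγ0 hγ1 x y
    (((continuous_basisFun hab hMx l).comp continuous_fst).mul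
      ((continuous_basisFun hcd hMy r).comp continuous_snd)).continuousOn

theorem integral_tensorSum_div_delta {γ a b c d : ℝ} {Mx My : ℕ} (hγ0 : 0 < γ) (hγ1 : γ < 1)
    (hab : a < b) (hcd : c < d) (hMx : 1 ≤ Mx) (hMy : 1 ≤ My) (i j : ℕ) (w : ℕ → ℕ → ℝ) :
    ∫ q in Omega a b c d, tensorSum a b c d Mx My w q /
        delta γ (node a b Mx i - q.1) (node c d My j - q.2)
      = ∑ l ∈ Finset.range (2 * Mx + 1), ∑ r ∈ Finset.range (2 * My + 1),
        basisCoeff γ a b c d Mx My i j l r * w l r := by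
  have hI := integrableOn_basis_div_delta hγ0 hγ1 hab hcd hMx hMy (node a b Mx i) (node c d My j)
  simp only [tensorSum, Finset.sum_div, mul_div_right_comm _ (w _ _)]
  rw [integral_finsetSum _ fun l _ => integrable_finsetSum _ fun r _ => (hI l r).mul_const _]
  refine Finset.sum_congr rfl fun l _ => ?_
  rw [integral_finsetSum _ fun r _ => (hI l r).mul_const _]
  refine Finset.sum_congr rfl fun r _ => ?_
  rw [integral_mul_const, basisCoeff]

theorem sum_range_eq_fin {M : ℕ} (hM : 1 ≤ M) (F : ℕ → ℝ) :
    ∑ l ∈ Finset.range (2 * M + 1), F l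
      = F 0 + F (2 * M) + ∑ i : Fin (2 * M - 1), F (i + 1) := by
  obtain ⟨n, hn⟩ : ∃ n, 2 * M = n + 1 := ⟨2 * M - 1, by omega⟩
  rw [hn, Finset.sum_range_succ, Finset.sum_range_succ', Nat.add_sub_cancel,
    ← Fin.sum_univ_eq_sum_range (fun i => F (i + 1))]
  ring

theorem sum_Icc_eq_fin (n : ℕ) (F : ℕ → ℝ) :
    ∑ l ∈ Finset.Icc 1 n, F l = ∑ i : Fin n, F (i + 1) := by
  rw [Fin.sum_univ_eq_sum_range (fun i => F (i + 1)), Finset.range_eq_Ico,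
    Finset.sum_Ico_add' F 0 n 1, zero_add]
  rfl

/-- Interior and boundary values together make up the full interpolant. The corners are counted
once, in the two sums with first index 0 or `2 * Mx`. -/
theorem matG_mulVec_add_boundaryVec {γ a b c d : ℝ} {Mx My : ℕ} (hMx : 1 ≤ Mx) (hMy : 1 ≤ My)
    (v : ℝ → ℝ → ℝ) (p : Index Mx My) :
    (matG γ a b c d Mx My).mulVec (gridFun a b c d Mx My v) p + boundaryVec γ a b c d Mx My v p
      = ∑ l ∈ Finset.range (2 * Mx + 1), ∑ r ∈ Finset.range (2 * My + 1),
        basisCoeff γ a b c d Mx My (p.1 + 1) (p.2 + 1) l r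
          * v (node a b Mx l) (node c d My r) := by
  have hIcc : ∀ F : ℕ → ℝ, ∑ r ∈ Finset.Icc 0 (2 * My), F r
      = ∑ r ∈ Finset.range (2 * My + 1), F r := fun F => by
    rw [Finset.range_eq_Ico]
    rfl
  rw [sum_range_eq_fin hMx, boundaryVec]
  simp only [sum_range_eq_fin hMy, hIcc, sum_Icc_eq_fin, Matrix.mulVec, dotProduct, matG,
    Matrix.of_apply, gridFun, Fintype.sum_prod_type, Finset.sum_add_distrib]
  ring

theorem matD_mulVec (γ a b c d : ℝ) (Mx My : ℕ) (V : Index Mx My → ℝ) (p : Index Mx My) :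
    (matD γ a b c d Mx My).mulVec V p = diagCoeff γ a b c d Mx My (p.1 + 1) (p.2 + 1) * V p := by
  rw [matD, Matrix.mulVec_diagonal]

theorem index_node_mem {a b : ℝ} {M : ℕ} (hab : a < b) (hM : 1 ≤ M) (i : Fin (2 * M - 1)) :
    node a b M (i + 1) ∈ Ioo a b :=
  node_mem_Ioo hab hM (Nat.succ_pos _) (by omega)

theorem constCd_pos {γ a b c d : ℝ} (hγ1 : γ < 1) (hab : a < b) (hcd : c < d) :
    0 < constCd γ a b c d := by
  have h1 : 0 < b - a := sub_pos.2 hab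
  have h2 : 0 < d - c := sub_pos.2 hcd
  have h3 : 0 < 1 - γ := sub_pos.2 hγ1
  unfold constCd
  positivity

theorem sum_fin_abs_basisFun_le {a b : ℝ} {M : ℕ} (hab : a < b) (hM : 1 ≤ M) {x : ℝ}
    (hx : x ∈ Icc a b) : ∑ i : Fin (2 * M - 1), |basisFun a b M (i + 1) x| ≤ 3 := by
  have h := sum_abs_basisFun_le hab hM hx
  rw [sum_range_eq_fin hM] at h
  have := abs_nonneg (basisFun a b M 0 x)
  have := abs_nonneg (basisFun a b M (2 * M) x)
  linarith

/-- The product is the kernel integral of the piecewise quadratic function with interior nodal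
values `V` and zero boundary values; pointwise this function is at most 3 · 3 · ‖V‖. -/
theorem abs_matG_mulVec_le {γ a b c d : ℝ} {Mx My : ℕ} (hγ0 : 0 < γ) (hγ1 : γ < 1)
    (hab : a < b) (hcd : c < d) (hMx : 1 ≤ Mx) (hMy : 1 ≤ My) (V : Index Mx My → ℝ)
    (p : Index Mx My) :
    |(matG γ a b c d Mx My).mulVec V p| ≤ 9 * ‖V‖ * constCd γ a b c d := by
  have hI := integrableOn_basis_div_delta hγ0 hγ1 hab hcd hMx hMy
    (node a b Mx (p.1 + 1)) (node c d My (p.2 + 1))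
  have h1 : (matG γ a b c d Mx My).mulVec V p = ∫ q in Omega a b c d,
      (∑ k : Index Mx My, basisFun a b Mx (k.1 + 1) q.1 * basisFun c d My (k.2 + 1) q.2 * V k) /
        delta γ (node a b Mx (p.1 + 1) - q.1) (node c d My (p.2 + 1) - q.2) := by
    simp only [Finset.sum_div, mul_div_right_comm _ (V _)]
    rw [integral_finsetSum _ fun k _ => (hI _ _).mul_const _]
    simp only [integral_mul_const, Matrix.mulVec, dotProduct, matG, Matrix.of_apply, basisCoeff]
  rw [h1]
  refine abs_integral_div_delta_le hγ0 hγ1 hab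
    (Ioo_subset_Icc_self (index_node_mem hcd hMy p.2)) _ fun q hq => ?_
  calc |∑ k : Index Mx My, basisFun a b Mx (k.1 + 1) q.1 * basisFun c d My (k.2 + 1) q.2 * V k|
      ≤ ∑ k : Index Mx My,
          |basisFun a b Mx (k.1 + 1) q.1 * basisFun c d My (k.2 + 1) q.2 * V k| :=
        Finset.abs_sum_le_sum_abs _ _
    _ ≤ ∑ k : Index Mx My,
          |basisFun a b Mx (k.1 + 1) q.1| * |basisFun c d My (k.2 + 1) q.2| * ‖V‖ := by
        refine Finset.sum_le_sum fun k _ => ?_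
        rw [abs_mul, abs_mul]
        exact mul_le_mul_of_nonneg_left (norm_le_pi_norm V k) (by positivity)
    _ = (∑ i : Fin (2 * Mx - 1), |basisFun a b Mx (i + 1) q.1|)
          * (∑ j : Fin (2 * My - 1), |basisFun c d My (j + 1) q.2|) * ‖V‖ := by
        rw [← Finset.sum_mul, Finset.sum_mul_sum, Fintype.sum_prod_type]
    _ ≤ 3 * 3 * ‖V‖ := by
        gcongr
        · exact sum_fin_abs_basisFun_le hab hMx hq.1
        · exact sum_fin_abs_basisFun_le hcd hMy hq.2
    _ = 9 * ‖V‖ := by norm_num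

/-- The collocation matrix is bounded in the maximum norm, uniformly in the mesh. -/
theorem norm_matA_mulVec_le {γ a b c d : ℝ} {Mx My : ℕ} (hγ0 : 0 < γ) (hγ1 : γ < 1)
    (hab : a < b) (hcd : c < d) (hMx : 1 ≤ Mx) (hMy : 1 ≤ My) (V : Index Mx My → ℝ) :
    ‖(matA γ a b c d Mx My).mulVec V‖ ≤ 10 * constCd γ a b c d * ‖V‖ := by
  have hC := constCd_pos hγ1 hab hcd
  refine (pi_norm_le_iff_of_nonneg (by positivity)).2 fun p => ?_
  rw [matA, Matrix.sub_mulVec, Pi.sub_apply, matD_mulVec, Real.norm_eq_abs]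
  have h1 : |diagCoeff γ a b c d Mx My (p.1 + 1) (p.2 + 1)| ≤ constCd γ a b c d := by
    have h := abs_integral_div_delta_le (K := 1) hγ0 hγ1 hab
      (Ioo_subset_Icc_self (index_node_mem hcd hMy p.2)) (node a b Mx (p.1 + 1))
      (F := fun _ => 1) (fun _ _ => by simp)
    rwa [one_mul] at h
  have h2 : |diagCoeff γ a b c d Mx My (p.1 + 1) (p.2 + 1) * V p| ≤ constCd γ a b c d * ‖V‖ := by
    rw [abs_mul]
    exact mul_le_mul h1 (norm_le_pi_norm V p) (abs_nonneg _) hC.le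
  refine (abs_sub _ _).trans ?_
  linarith [abs_matG_mulVec_le hγ0 hγ1 hab hcd hMx hMy V p]

/-! ### Smoothness of the slices -/

section Slices

open scoped Pointwise

/-- The slice is a linear map of norm at most 1 followed by a translation. Translations preserve the
derivative norms and the linear map does not increase them. -/
theorem norm_iteratedFDerivWithin_affine_slice_le {V : Type*} [NormedAddCommGroup V]
    [NormedSpace ℝ V] {F : V → ℝ} {S S' : Set V} {p : V} {ι : ℝ →L[ℝ] V} {n : ℕ}
    (hS : S = p +ᵥ S') (hF : ContDiffOn ℝ n F S) (hS' : UniqueDiffOn ℝ S')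
    (hι : ‖ι‖ ≤ 1) (hI : UniqueDiffOn ℝ (ι ⁻¹' S')) {x : ℝ} (hx : ι x ∈ S') :
    ‖iteratedFDerivWithin ℝ n (fun x => F (ι x + p)) (ι ⁻¹' S') x‖
      ≤ ‖iteratedFDerivWithin ℝ n F S (ι x + p)‖ := by
  have hG : ContDiffOn ℝ n (fun z => F (z + p)) S' := by
    refine hF.comp (contDiff_id.add contDiff_const).contDiffOn fun z hz => ?_
    rw [hS, mem_vadd_set]
    exact ⟨z, hz, add_comm _ _⟩
  have h1 := ι.iteratedFDerivWithin_comp_right hG hS' hI hx le_rfl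
  rw [iteratedFDerivWithin_comp_add_right, ← hS] at h1
  change ‖iteratedFDerivWithin ℝ n ((fun z => F (z + p)) ∘ ι) (ι ⁻¹' S') x‖ ≤ _
  rw [h1]
  refine (ContinuousMultilinearMap.norm_compContinuousLinearMap_le _ _).trans ?_
  rw [Finset.prod_const]
  exact mul_le_of_le_one_right (norm_nonneg _) (pow_le_one₀ (norm_nonneg _) hι)

theorem abs_iteratedDerivWithin_slice_fst_le {a b c d y : ℝ} {F : ℝ × ℝ → ℝ} {n : ℕ} (hab : a < b)
    (hcd : c < d) (hF : ContDiffOn ℝ n F (Icc a b ×ˢ Icc c d)) (hy : y ∈ Icc c d) {x : ℝ}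
    (hx : x ∈ Icc a b) :
    |iteratedDerivWithin n (fun x => F (x, y)) (Icc a b) x|
      ≤ ‖iteratedFDerivWithin ℝ n F (Icc a b ×ˢ Icc c d) (x, y)‖ := by
  -- The rectangle is shifted so that the slice passes through the origin and becomes the image of a
  -- linear map.
  have hpre : ContinuousLinearMap.inl ℝ ℝ ℝ ⁻¹' (Icc a b ×ˢ Icc (c - y) (d - y)) = Icc a b := by
    ext r
    simp [hy.1, hy.2]
  have h := norm_iteratedFDerivWithin_affine_slice_le (S' := Icc a b ×ˢ Icc (c - y) (d - y))
    (p := (0, y)) (ι := ContinuousLinearMap.inl ℝ ℝ ℝ) (x := x) (n := n) (by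
      ext ⟨r, s⟩
      simp [mem_vadd_set_iff_neg_vadd_mem, add_comm]) hF
    ((uniqueDiffOn_Icc hab).prod (uniqueDiffOn_Icc (by linarith)))
    (ContinuousLinearMap.norm_inl_le_one ℝ ℝ ℝ) (by
      rw [hpre]
      exact uniqueDiffOn_Icc hab) (by rwa [← mem_preimage, hpre])
  rw [hpre] at h
  rw [← Real.norm_eq_abs, ← norm_iteratedFDerivWithin_eq_norm_iteratedDerivWithin]
  simpa using h

theorem abs_iteratedDerivWithin_slice_snd_le {a b c d x : ℝ} {F : ℝ × ℝ → ℝ} {n : ℕ} (hab : a < b)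
    (hcd : c < d) (hF : ContDiffOn ℝ n F (Icc a b ×ˢ Icc c d)) (hx : x ∈ Icc a b) {y : ℝ}
    (hy : y ∈ Icc c d) :
    |iteratedDerivWithin n (fun y => F (x, y)) (Icc c d) y|
      ≤ ‖iteratedFDerivWithin ℝ n F (Icc a b ×ˢ Icc c d) (x, y)‖ := by
  have hpre : ContinuousLinearMap.inr ℝ ℝ ℝ ⁻¹' (Icc (a - x) (b - x) ×ˢ Icc c d) = Icc c d := by
    ext r
    simp [hx.1, hx.2]
  have h := norm_iteratedFDerivWithin_affine_slice_le (S' := Icc (a - x) (b - x) ×ˢ Icc c d)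
    (p := (x, 0)) (ι := ContinuousLinearMap.inr ℝ ℝ ℝ) (x := y) (n := n) (by
      ext ⟨r, s⟩
      simp [mem_vadd_set_iff_neg_vadd_mem, add_comm]) hF
    ((uniqueDiffOn_Icc (by linarith)).prod (uniqueDiffOn_Icc hcd))
    (ContinuousLinearMap.norm_inr_le_one ℝ ℝ ℝ) (by
      rw [hpre]
      exact uniqueDiffOn_Icc hcd) (by rwa [← mem_preimage, hpre])
  rw [hpre] at h
  rw [← Real.norm_eq_abs, ← norm_iteratedFDerivWithin_eq_norm_iteratedDerivWithin]
  simpa using h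

end Slices

/-- Smoothness on the rectangle gives uniform cubic expansions along both coordinates. -/
theorem hasCubicExpansion_slices {a b c d B : ℝ} (hab : a < b) (hcd : c < d) {v : ℝ → ℝ → ℝ}
    (hv : ContDiffOn ℝ 6 (fun p : ℝ × ℝ => v p.1 p.2) (Icc a b ×ˢ Icc c d))
    (hB : ∀ p ∈ Icc a b ×ˢ Icc c d, ∀ m : ℕ, m ≤ 6 →
      ‖iteratedFDerivWithin ℝ m (fun p : ℝ × ℝ => v p.1 p.2) (Icc a b ×ˢ Icc c d) p‖ ≤ B) :
    (∀ y ∈ Icc c d, HasCubicExpansion a b B fun x => v x y) ∧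
      ∀ x ∈ Icc a b, HasCubicExpansion c d B (v x) := by
  have hle : ∀ m : ℕ, m ≤ 4 →
      ContDiffOn ℝ m (fun p : ℝ × ℝ => v p.1 p.2) (Icc a b ×ˢ Icc c d) := fun m hm =>
    hv.of_le (by exact_mod_cast hm.trans (by norm_num))
  have h4 := hle 4 le_rfl
  refine ⟨fun y hy => hasCubicExpansion_of_contDiffOn ?_ fun x hx m hm => ?_,
    fun x hx => hasCubicExpansion_of_contDiffOn ?_ fun y hy m hm => ?_⟩
  · exact h4.comp (f := fun x : ℝ => (x, y)) (contDiff_id.prodMk contDiff_const).contDiffOn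
      fun _ hx => ⟨hx, hy⟩
  · exact (abs_iteratedDerivWithin_slice_fst_le hab hcd (hle m hm) hy hx).trans
      (hB _ ⟨hx, hy⟩ m (hm.trans (by norm_num)))
  · exact h4.comp (f := fun y : ℝ => (x, y)) (contDiff_const.prodMk contDiff_id).contDiffOn
      fun _ hy => ⟨hx, hy⟩
  · exact (abs_iteratedDerivWithin_slice_snd_le hab hcd (hle m hm) hx hy).trans
      (hB _ ⟨hx, hy⟩ m (hm.trans (by norm_num)))

/-! ### Consistency in time -/

theorem abs_sub_taylor_one_le {f : ℝ → ℝ} {T B p s : ℝ} (hf : ContDiffOn ℝ 2 f (Icc 0 T))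
    (hB : ∀ t ∈ Icc 0 T, |iteratedDerivWithin 2 f (Icc 0 T) t| ≤ B) (hp : 0 ≤ p) (hs : 0 < s)
    (hps : p + s ≤ T) :
    |f (p + s) - (f p + s * derivWithin f (Icc 0 T) p)| ≤ B * s ^ 2 := by
  have hpT : p < T := by linarith
  have hpm : p ∈ Icc p T := left_mem_Icc.2 hpT.le
  have h1 := taylor_mean_remainder_bound (n := 1) (C := B) (x := p + s) hpT.le
    ((hf.mono (Icc_subset_Icc_left hp)).of_le (by norm_num)) ⟨by linarith, hps⟩ fun y hy => by
      rw [iteratedDerivWithin_Icc_left (by simpa using hf) hp hpT hy]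
      exact hB y (Icc_subset_Icc_left hp hy)
  simp only [taylorWithinEval_succ, taylor_within_zero_eval, add_sub_cancel_left,
    Real.norm_eq_abs, smul_eq_mul] at h1
  rw [iteratedDerivWithin_Icc_left (hf.of_le (by norm_num)) hp hpT hpm] at h1
  norm_num [Nat.factorial] at h1
  exact h1

theorem abs_sub_taylor_two_le {f : ℝ → ℝ} {T B p s : ℝ} (hf : ContDiffOn ℝ 3 f (Icc 0 T))
    (hB : ∀ t ∈ Icc 0 T, |iteratedDerivWithin 3 f (Icc 0 T) t| ≤ B) (hp : 0 ≤ p) (hs : 0 < s)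
    (hps : p + s ≤ T) :
    |f (p + s) - (f p + s * derivWithin f (Icc 0 T) p
      + s ^ 2 / 2 * iteratedDerivWithin 2 f (Icc 0 T) p)| ≤ B * s ^ 3 / 2 := by
  have hpT : p < T := by linarith
  have hpm : p ∈ Icc p T := left_mem_Icc.2 hpT.le
  have h1 := taylor_mean_remainder_bound (n := 2) (C := B) (x := p + s) hpT.le
    ((hf.mono (Icc_subset_Icc_left hp)).of_le (by norm_num)) ⟨by linarith, hps⟩ fun y hy => by
      rw [iteratedDerivWithin_Icc_left (by simpa using hf) hp hpT hy]
      exact hB y (Icc_subset_Icc_left hp hy)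
  simp only [taylorWithinEval_succ, taylor_within_zero_eval, add_sub_cancel_left,
    Real.norm_eq_abs, smul_eq_mul] at h1
  rw [iteratedDerivWithin_Icc_left (hf.of_le (by norm_num)) hp hpT hpm,
    iteratedDerivWithin_Icc_left (hf.of_le (by norm_num)) hp hpT hpm] at h1
  norm_num [Nat.factorial] at h1
  refine (le_of_eq ?_).trans h1
  congr 1
  ring

/-- Expanding the increment and the midpoint derivative about the left end, the second-order terms
cancel; the remainders add up to at most (1/2 + 1/4)Bτ³. -/
theorem abs_midpoint_derivative_error_le {f : ℝ → ℝ} {T B p τ : ℝ}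
    (hf : ContDiffOn ℝ 3 f (Icc 0 T))
    (hB : ∀ t ∈ Icc 0 T, |iteratedDerivWithin 3 f (Icc 0 T) t| ≤ B) (hp : 0 ≤ p) (hτ : 0 < τ)
    (hpτ : p + τ ≤ T) :
    |f (p + τ) - f p - τ * derivWithin f (Icc 0 T) (p + τ / 2)| ≤ B * τ ^ 3 := by
  have hT : 0 < T := by linarith
  have h1 := abs_sub_taylor_two_le hf hB hp hτ hpτ
  have h2 := abs_sub_taylor_one_le (f := derivWithin f (Icc 0 T)) (s := τ / 2)
    (hf.derivWithin (uniqueDiffOn_Icc hT) (by norm_num))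
    (fun t ht => by
      rw [← iteratedDerivWithin_succ']
      exact hB t ht) hp (by linarith) (by linarith)
  have h3 : derivWithin (derivWithin f (Icc 0 T)) (Icc 0 T) p
      = iteratedDerivWithin 2 f (Icc 0 T) p := by
    rw [iteratedDerivWithin_succ', iteratedDerivWithin_one]
  have hB0 : 0 ≤ B := (abs_nonneg _).trans (hB 0 (left_mem_Icc.2 hT.le))
  rw [h3] at h2
  have h4 : τ * |derivWithin f (Icc 0 T) (p + τ / 2) - (derivWithin f (Icc 0 T) p
      + τ / 2 * iteratedDerivWithin 2 f (Icc 0 T) p)| ≤ τ * (B * (τ / 2) ^ 2) :=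
    mul_le_mul_of_nonneg_left h2 hτ.le
  rw [← abs_of_pos hτ, ← abs_mul, abs_of_pos hτ] at h4
  have h1 := abs_le.1 h1
  have h4 := abs_le.1 h4
  have h5 : 0 ≤ B * τ ^ 3 := by positivity
  rw [abs_le]
  constructor <;> nlinarith

theorem abs_midpoint_value_error_le {f : ℝ → ℝ} {T B p τ : ℝ} (hf : ContDiffOn ℝ 2 f (Icc 0 T))
    (hB : ∀ t ∈ Icc 0 T, |iteratedDerivWithin 2 f (Icc 0 T) t| ≤ B) (hp : 0 ≤ p) (hτ : 0 < τ)
    (hpτ : p + τ ≤ T) : |(f p + f (p + τ)) / 2 - f (p + τ / 2)| ≤ B * τ ^ 2 := by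
  have h1 := abs_le.1 (abs_sub_taylor_one_le hf hB hp hτ hpτ)
  have h2 := abs_le.1 (abs_sub_taylor_one_le (s := τ / 2) hf hB hp (by linarith) (by linarith))
  have hB0 : 0 ≤ B := (abs_nonneg _).trans (hB 0 (left_mem_Icc.2 (by linarith)))
  have h5 : 0 ≤ B * τ ^ 2 := by positivity
  rw [abs_le]
  constructor <;> nlinarith

/-! ### Stability of the Crank-Nicolson method -/

/-- A null vector satisfies V = -(τ/2)AV, hence ‖V‖ ≤ ‖V‖/2. -/
theorem eq_zero_of_one_add_smul_mulVec {ι : Type*} [Fintype ι] [DecidableEq ι]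
    {A : Matrix ι ι ℝ} {L τ : ℝ} (hA : ∀ V : ι → ℝ, ‖A.mulVec V‖ ≤ L * ‖V‖) (hτ : 0 < τ)
    (hτL : τ * L ≤ 1) {V : ι → ℝ} (hV : (1 + (τ / 2) • A).mulVec V = 0) : V = 0 := by
  rw [Matrix.add_mulVec, Matrix.one_mulVec, Matrix.smul_mulVec] at hV
  have h1 : ‖V‖ = τ / 2 * ‖A.mulVec V‖ := by
    rw [eq_neg_of_add_eq_zero_left hV, norm_neg, norm_smul, Real.norm_of_nonneg (by linarith),
      ← eq_neg_of_add_eq_zero_left hV]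
  have h2 := mul_le_mul_of_nonneg_left (hA V) (by linarith : 0 ≤ τ / 2)
  have h3 := mul_le_mul_of_nonneg_right hτL (norm_nonneg V)
  have h4 : ‖V‖ ≤ 0 := by nlinarith
  exact norm_le_zero_iff.1 h4

theorem bijective_one_add_smul_mulVec {ι : Type*} [Fintype ι] [DecidableEq ι]
    {A : Matrix ι ι ℝ} {L τ : ℝ} (hA : ∀ V : ι → ℝ, ‖A.mulVec V‖ ≤ L * ‖V‖) (hτ : 0 < τ)
    (hτL : τ * L ≤ 1) : Function.Bijective (1 + (τ / 2) • A).mulVec := by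
  have hinj : Function.Injective (1 + (τ / 2) • A).mulVecLin :=
    (injective_iff_map_eq_zero _).2 fun V hV => eq_zero_of_one_add_smul_mulVec hA hτ hτL hV
  exact ⟨hinj, LinearMap.injective_iff_surjective.1 hinj⟩

/-- Each step is implicit: a right inverse of Φ builds the sequence, and injectivity of Φ makes it
unique. -/
theorem existsUnique_fin_recursion {X : Type*} {N : ℕ} (x₀ : X) {Φ : X → X}
    (hΦ : Function.Bijective Φ) (Ψ : ℕ → X → X) :
    ∃! U : Fin (N + 1) → X, U 0 = x₀ ∧ ∀ k : Fin N, Φ (U k.succ) = Ψ k (U k.castSucc) := by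
  obtain ⟨Θ, hΘ⟩ := hΦ.2.hasRightInverse
  let W : ℕ → X := fun n => Nat.rec (motive := fun _ => X) x₀ (fun n V => Θ (Ψ n V)) n
  refine ⟨fun k => W k, ⟨rfl, fun k => hΘ (Ψ k (W k))⟩, ?_⟩
  rintro U ⟨h0, hU⟩
  funext k
  induction k using Fin.induction with
  | zero => exact h0
  | succ k ih =>
    apply hΦ.1
    rw [hU k, ih]
    exact (hΘ _).symm

theorem discrete_gronwall {N : ℕ} {E : Fin (N + 1) → ℝ} {L τ R : ℝ} (hL : 0 ≤ L) (hτ : 0 < τ)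
    (hτL : τ * L ≤ 1) (hR : 0 ≤ R) (hE : ∀ k, 0 ≤ E k) (h0 : E 0 = 0)
    (hstep : ∀ k : Fin N,
      E k.succ ≤ E k.castSucc + τ / 2 * L * (E k.castSucc + E k.succ) + τ * R)
    (k : Fin (N + 1)) : E k ≤ Real.exp (2 * L * (k * τ)) * (2 * R * (k * τ)) := by
  induction k using Fin.induction with
  | zero => simp [h0]
  | succ k ih =>
    have hs := hstep k
    simp only [Fin.val_castSucc] at ih
    have h1 : E k.succ ≤ (1 + 2 * L * τ) * E k.castSucc + 2 * τ * R := by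
      set x := E k.castSucc
      set z := E k.succ
      have hx : 0 ≤ x := hE _
      have hq : 0 ≤ τ * L := by positivity
      have h2 : (1 - τ * L / 2) * z ≤ (1 + τ * L / 2) * x + τ * R := by linarith
      -- With q = τL ≤ 1, division by 1 - q/2 is avoided through 1 + q/2 ≤ (1 - q/2)(1 + 2q) and 1 ≤
      -- 2(1 - q/2).
      have h3 : (1 + τ * L / 2) * x + τ * R
          ≤ (1 - τ * L / 2) * ((1 + 2 * L * τ) * x + 2 * τ * R) := by
        have e1 : 0 ≤ (τ * L) * (1 - τ * L) * x :=
          mul_nonneg (mul_nonneg hq (by linarith)) hx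
        have e2 : 0 ≤ (1 - τ * L) * (τ * R) := mul_nonneg (by linarith) (by positivity)
        nlinarith
      exact le_of_mul_le_mul_left (h2.trans h3) (by linarith)
    have hexp : 1 + 2 * L * τ ≤ Real.exp (2 * L * τ) := by
      linarith [Real.add_one_le_exp (2 * L * τ)]
    have hsplit : Real.exp (2 * L * ((k.succ : ℕ) * τ))
        = Real.exp (2 * L * τ) * Real.exp (2 * L * (k * τ)) := by
      rw [← Real.exp_add]
      congr 1
      push_cast [Fin.val_succ]
      ring
    have hone : 1 ≤ Real.exp (2 * L * ((k.succ : ℕ) * τ)) := Real.one_le_exp (by positivity)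
    calc E k.succ ≤ (1 + 2 * L * τ) * E k.castSucc + 2 * τ * R := h1
      _ ≤ Real.exp (2 * L * τ) * (Real.exp (2 * L * (k * τ)) * (2 * R * (k * τ)))
          + Real.exp (2 * L * ((k.succ : ℕ) * τ)) * (2 * τ * R) := by
        refine add_le_add (mul_le_mul hexp ih (hE _) (Real.exp_pos _).le) ?_
        exact le_mul_of_one_le_left (by positivity) hone
      _ = Real.exp (2 * L * ((k.succ : ℕ) * τ)) * (2 * R * ((k.succ : ℕ) * τ)) := by
        rw [hsplit]
        push_cast [Fin.val_succ]
        ring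

/-! ### The truncation error of the scheme -/

theorem mem_frontier_Omega {a b c d : ℝ} (hab : a < b) (hcd : c < d) {x y : ℝ}
    (hx : x ∈ Icc a b) (hy : y ∈ Icc c d) (h : x ∉ Ioo a b ∨ y ∉ Ioo c d) :
    (x, y) ∈ frontier (Omega a b c d) := by
  have hopen : IsOpen (Omega a b c d) := isOpen_Ioo.prod isOpen_Ioo
  rw [hopen.frontier_eq, Omega, closure_prod_eq, closure_Ioo hab.ne, closure_Ioo hcd.ne]
  refine ⟨⟨hx, hy⟩, fun hmem => ?_⟩
  rcases h with h | h
  · exact h hmem.1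
  · exact h hmem.2

theorem boundaryVec_congr {γ a b c d : ℝ} {Mx My : ℕ} (hab : a < b) (hcd : c < d)
    (hMx : 1 ≤ Mx) (hMy : 1 ≤ My) {v w : ℝ → ℝ → ℝ}
    (h : ∀ x y, (x, y) ∈ frontier (Omega a b c d) → v x y = w x y) :
    boundaryVec γ a b c d Mx My v = boundaryVec γ a b c d Mx My w := by
  have ha : a ∈ Icc a b := left_mem_Icc.2 hab.le
  have hb : b ∈ Icc a b := right_mem_Icc.2 hab.le
  have hc : c ∈ Icc c d := left_mem_Icc.2 hcd.le
  have hd : d ∈ Icc c d := right_mem_Icc.2 hcd.le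
  funext p
  simp only [boundaryVec, node_zero, node_two_mul hMx, node_two_mul hMy]
  congr 1
  · congr 1
    · congr 1
      · refine Finset.sum_congr rfl fun r hr => ?_
        rw [h a _ (mem_frontier_Omega hab hcd ha
          (node_mem_Icc hcd hMy (Finset.mem_Icc.1 hr).2) (Or.inl (by simp)))]
      · refine Finset.sum_congr rfl fun r hr => ?_
        rw [h b _ (mem_frontier_Omega hab hcd hb
          (node_mem_Icc hcd hMy (Finset.mem_Icc.1 hr).2) (Or.inl (by simp)))]
    · refine Finset.sum_congr rfl fun l hl => ?_
      rw [h _ c (mem_frontier_Omega hab hcd (node_mem_Icc hab hMx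
        ((Finset.mem_Icc.1 hl).2.trans (Nat.sub_le _ _))) hc (Or.inr (by simp)))]
  · refine Finset.sum_congr rfl fun l hl => ?_
    rw [h _ d (mem_frontier_Omega hab hcd (node_mem_Icc hab hMx
      ((Finset.mem_Icc.1 hl).2.trans (Nat.sub_le _ _))) hd (Or.inr (by simp)))]

/-- The residual of the discrete operator is an integral of the interpolation error. -/
theorem matA_mulVec_sub_boundaryVec {γ a b c d : ℝ} {Mx My : ℕ} (hγ0 : 0 < γ) (hγ1 : γ < 1)
    (hab : a < b) (hcd : c < d) (hMx : 1 ≤ Mx) (hMy : 1 ≤ My) {v : ℝ → ℝ → ℝ}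
    (hv : ContinuousOn (fun q : ℝ × ℝ => v q.1 q.2) (Icc a b ×ˢ Icc c d)) (p : Index Mx My) :
    (matA γ a b c d Mx My).mulVec (gridFun a b c d Mx My v) p - boundaryVec γ a b c d Mx My v p
      = (∫ q in Omega a b c d,
          (v (node a b Mx (p.1 + 1)) (node c d My (p.2 + 1)) - v q.1 q.2) /
            delta γ (node a b Mx (p.1 + 1) - q.1) (node c d My (p.2 + 1) - q.2))
        + ∫ q in Omega a b c d, (v q.1 q.2
          - tensorSum a b c d Mx My (fun l r => v (node a b Mx l) (node c d My r)) q) /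
            delta γ (node a b Mx (p.1 + 1) - q.1) (node c d My (p.2 + 1) - q.2) := by
  have hG := matG_mulVec_add_boundaryVec (γ := γ) (a := a) (b := b) (c := c) (d := d) hMx hMy v p
  rw [← integral_tensorSum_div_delta hγ0 hγ1 hab hcd hMx hMy _ _
    fun l r => v (node a b Mx l) (node c d My r)] at hG
  rw [matA, Matrix.sub_mulVec, Pi.sub_apply, matD_mulVec]
  have hI : ∀ {F : ℝ × ℝ → ℝ}, ContinuousOn F (Icc a b ×ˢ Icc c d) → IntegrableOn
      (fun q => F q / delta γ (node a b Mx (p.1 + 1) - q.1) (node c d My (p.2 + 1) - q.2))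
      (Omega a b c d) := fun hF => integrableOn_div_delta_of_continuousOn hγ0 hγ1 _ _ hF
  have hT := continuous_tensorSum hab hcd hMx hMy fun l r => v (node a b Mx l) (node c d My r)
  have hconst : diagCoeff γ a b c d Mx My (p.1 + 1) (p.2 + 1) * gridFun a b c d Mx My v p
      = ∫ q in Omega a b c d, v (node a b Mx (p.1 + 1)) (node c d My (p.2 + 1)) /
            delta γ (node a b Mx (p.1 + 1) - q.1) (node c d My (p.2 + 1) - q.2) := by
    rw [diagCoeff, ← integral_mul_const]
    simp only [gridFun, one_div_mul_eq_div]
  rw [hconst]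
  simp only [sub_div]
  rw [integral_sub (hI continuousOn_const) (hI hv), integral_sub (hI hv) (hI hT.continuousOn)]
  linarith

/-- The residual of the exact solution in one step of the scheme. -/
noncomputable def stepResidual (γ a b c d : ℝ) (f g : ℝ → ℝ → ℝ → ℝ) (Mx My : ℕ) (τ : ℝ)
    (u : ℝ → ℝ → ℝ → ℝ) (k : ℕ) : Index Mx My → ℝ :=
  gridFun a b c d Mx My (fun x y => u x y ((k + 1 : ℕ) * τ))
    - gridFun a b c d Mx My (fun x y => u x y (k * τ))
    + (τ / 2) • (matA γ a b c d Mx My).mulVec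
        (gridFun a b c d Mx My (fun x y => u x y (k * τ))
          + gridFun a b c d Mx My (fun x y => u x y ((k + 1 : ℕ) * τ)))
    - τ • gridFun a b c d Mx My (fun x y => f x y (((k : ℝ) + 1 / 2) * τ))
    - τ • boundaryVec γ a b c d Mx My (fun x y => g x y (((k : ℝ) + 1 / 2) * τ))

/-- The residual has three parts: the difference quotient against the time derivative at the
midpoint, τA applied to average minus midpoint value, and τ times the spatial consistency error at
the midpoint. The equation at the midpoint removes `f`, and the boundary condition replaces `g` by
`u`. -/
theorem norm_stepResidual_le {γ a b c d T B B' : ℝ} (hγ0 : 0 < γ) (hγ1 : γ < 1) (hab : a < b)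
    (hcd : c < d) {f g : ℝ → ℝ → ℝ → ℝ} {u₀ : ℝ → ℝ → ℝ} {u : ℝ → ℝ → ℝ → ℝ}
    (hu : IsExactSolution γ a b c d T f g u₀ u) (hsmooth : IsSmooth a b c d T u)
    (hB : ∀ t ∈ Icc 0 T, ∀ p ∈ Icc a b ×ˢ Icc c d, ∀ m : ℕ, m ≤ 6 →
      ‖iteratedFDerivWithin ℝ m (fun p : ℝ × ℝ => u p.1 p.2 t) (Icc a b ×ˢ Icc c d) p‖ ≤ B)
    (hB' : ∀ x ∈ Icc a b, ∀ y ∈ Icc c d, ∀ t ∈ Icc 0 T, ∀ m : ℕ, m ≤ 3 →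
      |iteratedDerivWithin m (fun t => u x y t) (Icc 0 T) t| ≤ B')
    {Mx My : ℕ} (hMx : 1 ≤ Mx) (hMy : 1 ≤ My) {τ : ℝ} (hτ : 0 < τ) {k : ℕ}
    (hk : (k + 1 : ℕ) * τ ≤ T) :
    ‖stepResidual γ a b c d f g Mx My τ u k‖
      ≤ τ * (B' * (1 + 10 * constCd γ a b c d) * τ ^ 2
        + interpConst γ a b B * (d - c) * meshSize a b Mx ^ (4 - γ)
        + 3 * interpConst γ c d B * (b - a) * meshSize c d My ^ (4 - γ)) := by
  have hCd := constCd_pos hγ1 hab hcd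
  have hhx := meshSize_pos hab hMx
  have hhy := meshSize_pos hcd hMy
  push_cast at hk
  have hkτ : 0 ≤ k * τ := by positivity
  have hkτ' : k * τ + τ ≤ T := by linarith
  have hT : 0 < T := by linarith
  have hmidT : ((k : ℝ) + 1 / 2) * τ ∈ Ioc 0 T := ⟨by positivity, by linarith⟩
  have hmid : ((k : ℝ) + 1 / 2) * τ = k * τ + τ / 2 := by ring
  have hend : ((k + 1 : ℕ) : ℝ) * τ = k * τ + τ := by push_cast; ring
  have hmidI : k * τ + τ / 2 ∈ Icc 0 T := by
    rw [← hmid]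
    exact Ioc_subset_Icc_self hmidT
  have hB0 : 0 ≤ B := (norm_nonneg _).trans
    (hB _ hmidI (a, c) ⟨left_mem_Icc.2 hab.le, left_mem_Icc.2 hcd.le⟩ 0 (by norm_num))
  have hB'0 : 0 ≤ B' := (abs_nonneg _).trans
    (hB' a (left_mem_Icc.2 hab.le) c (left_mem_Icc.2 hcd.le) _ hmidI 0 (by norm_num))
  have hba : 0 < b - a := sub_pos.2 hab
  have hdc : 0 < d - c := sub_pos.2 hcd
  have hγ' : 0 < 1 - γ := sub_pos.2 hγ1
  have hbd : boundaryVec γ a b c d Mx My (fun x y => g x y (k * τ + τ / 2))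
      = boundaryVec γ a b c d Mx My (fun x y => u x y (k * τ + τ / 2)) :=
    boundaryVec_congr hab hcd hMx hMy fun x y hxy =>
      (hu.boundary x y _ hxy (hmid ▸ hmidT)).symm
  unfold stepResidual
  rw [hmid, hend, hbd]
  set A := matA γ a b c d Mx My
  set v₀ := gridFun a b c d Mx My (fun x y => u x y (k * τ)) with hv₀
  set v₁ := gridFun a b c d Mx My (fun x y => u x y (k * τ + τ)) with hv₁
  set vm := gridFun a b c d Mx My (fun x y => u x y (k * τ + τ / 2)) with hvm
  have hmem : ∀ p : Index Mx My,
      node a b Mx (p.1 + 1) ∈ Ioo a b ∧ node c d My (p.2 + 1) ∈ Ioo c d := fun p =>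
    ⟨index_node_mem hab hMx p.1, index_node_mem hcd hMy p.2⟩
  have havg : ‖(1 / 2 : ℝ) • (v₀ + v₁) - vm‖ ≤ B' * τ ^ 2 := by
    refine (pi_norm_le_iff_of_nonneg (by positivity)).2 fun p => ?_
    have hx := Ioo_subset_Icc_self (hmem p).1
    have hy := Ioo_subset_Icc_self (hmem p).2
    have := abs_midpoint_value_error_le ((hsmooth.time _ hx _ hy).of_le (by norm_num))
      (fun t ht => hB' _ hx _ hy t ht 2 (by norm_num)) hkτ hτ hkτ'
    rw [Real.norm_eq_abs]
    refine (le_of_eq ?_).trans this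
    simp only [hv₀, hv₁, hvm, Pi.sub_apply, Pi.smul_apply, Pi.add_apply, smul_eq_mul, gridFun]
    congr 1
    ring
  have hAavg := (norm_matA_mulVec_le hγ0 hγ1 hab hcd hMx hMy _).trans
    (mul_le_mul_of_nonneg_left havg (by positivity : 0 ≤ 10 * constCd γ a b c d))
  refine (pi_norm_le_iff_of_nonneg ?_).2 fun p => ?_
  · unfold interpConst
    positivity
  obtain ⟨hxo, hyo⟩ := hmem p
  have hx := Ioo_subset_Icc_self hxo
  have hy := Ioo_subset_Icc_self hyo
  have hderiv := (hu.equation (node a b Mx (p.1 + 1)) (node c d My (p.2 + 1)) _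
    ⟨hxo, hyo⟩ (hmid ▸ hmidT)).derivWithin (uniqueDiffOn_Icc hT _ hmidI)
  have htime := abs_midpoint_derivative_error_le (hsmooth.time _ hx _ hy)
    (fun t ht => hB' _ hx _ hy t ht 3 le_rfl) hkτ hτ hkτ'
  rw [hderiv] at htime
  have hspace := hsmooth.space _ hmidI
  obtain ⟨hex, hey⟩ := hasCubicExpansion_slices (v := fun x y => u x y (k * τ + τ / 2)) hab hcd
    hspace (hB _ hmidI)
  have hcons := abs_integral_sub_tensorSum_le hγ0 hγ1 hab hcd hMx hMy hspace.continuousOn hex hey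
    hB0 hx hy
  have hop := matA_mulVec_sub_boundaryVec (v := fun x y => u x y (k * τ + τ / 2)) hγ0 hγ1
    hab hcd hMx hMy hspace.continuousOn p
  have hAp := (norm_le_pi_norm _ p).trans hAavg
  rw [Matrix.mulVec_sub, Matrix.mulVec_smul] at hAp
  simp only [Real.norm_eq_abs, Pi.sub_apply, Pi.smul_apply, smul_eq_mul, Pi.add_apply]
    at hAp hop ⊢
  set I₁ := ∫ q in Omega a b c d, (u (node a b Mx (p.1 + 1)) (node c d My (p.2 + 1))
    (k * τ + τ / 2) - u q.1 q.2 (k * τ + τ / 2)) /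
      delta γ (node a b Mx (p.1 + 1) - q.1) (node c d My (p.2 + 1) - q.2)
  set I₂ := ∫ q in Omega a b c d, (u q.1 q.2 (k * τ + τ / 2) - tensorSum a b c d Mx My
    (fun l r => u (node a b Mx l) (node c d My r) (k * τ + τ / 2)) q) /
      delta γ (node a b Mx (p.1 + 1) - q.1) (node c d My (p.2 + 1) - q.2)
  have h0 : v₀ p = u (node a b Mx (p.1 + 1)) (node c d My (p.2 + 1)) (k * τ) := rfl
  have h1 : v₁ p = u (node a b Mx (p.1 + 1)) (node c d My (p.2 + 1)) (k * τ + τ) := rfl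
  have hf : gridFun a b c d Mx My (fun x y => f x y (k * τ + τ / 2)) p
      = f (node a b Mx (p.1 + 1)) (node c d My (p.2 + 1)) (k * τ + τ / 2) := rfl
  rw [← h0, ← h1, ← hf] at htime
  have hAτ := mul_le_mul_of_nonneg_left hAp hτ.le
  rw [← abs_of_pos hτ, ← abs_mul, abs_of_pos hτ] at hAτ
  have hcτ := mul_le_mul_of_nonneg_left hcons hτ.le
  rw [← abs_of_pos hτ, ← abs_mul, abs_of_pos hτ] at hcτ
  have htime := abs_le.1 htime
  have hAτ := abs_le.1 hAτ
  have hcτ := abs_le.1 hcτ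
  -- The nonlocal integral `I₁` cancels between the equation in `htime` and the discrete operator in
  -- `hop`; only the consistency error `I₂` remains.
  have hopτ := congrArg (τ * ·) hop
  rw [abs_le]
  constructor <;> linarith

theorem error_step {γ a b c d : ℝ} {f g : ℝ → ℝ → ℝ → ℝ} {u₀ : ℝ → ℝ → ℝ}
    {u : ℝ → ℝ → ℝ → ℝ} {Mx My N : ℕ} {τ : ℝ} {U : Fin (N + 1) → Index Mx My → ℝ}
    (hU : IsSchemeSolution γ a b c d f g u₀ Mx My N τ U) (k : Fin N) :
    gridFun a b c d Mx My (fun x y => u x y ((k.succ : ℕ) * τ)) - U k.succ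
      = (gridFun a b c d Mx My (fun x y => u x y ((k.castSucc : ℕ) * τ)) - U k.castSucc)
        - (τ / 2) • (matA γ a b c d Mx My).mulVec
          ((gridFun a b c d Mx My (fun x y => u x y ((k.castSucc : ℕ) * τ)) - U k.castSucc)
            + (gridFun a b c d Mx My (fun x y => u x y ((k.succ : ℕ) * τ)) - U k.succ))
        + stepResidual γ a b c d f g Mx My τ u k := by
  have hs := hU.step k
  rw [Matrix.add_mulVec, Matrix.sub_mulVec, Matrix.one_mulVec, Matrix.one_mulVec,
    Matrix.smul_mulVec, Matrix.smul_mulVec] at hs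
  simp only [stepResidual, Fin.val_succ, Fin.val_castSucc, Matrix.mulVec_add, Matrix.mulVec_sub]
  funext p
  have hp := congrFun hs p
  simp only [Pi.add_apply, Pi.sub_apply, Pi.smul_apply, smul_eq_mul] at hp ⊢
  linarith

theorem existsUnique_schemeSolution {γ a b c d : ℝ} (hγ0 : 0 < γ) (hγ1 : γ < 1) (hab : a < b)
    (hcd : c < d) (f g : ℝ → ℝ → ℝ → ℝ) (u₀ : ℝ → ℝ → ℝ) {Mx My : ℕ} (N : ℕ) {τ : ℝ}
    (hMx : 1 ≤ Mx) (hMy : 1 ≤ My) (hτ : 0 < τ) (hτC : τ * (10 * constCd γ a b c d) ≤ 1) :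
    ∃! U : Fin (N + 1) → Index Mx My → ℝ, IsSchemeSolution γ a b c d f g u₀ Mx My N τ U := by
  obtain ⟨U, ⟨h0, hs⟩, huniq⟩ := existsUnique_fin_recursion (N := N)
    (gridFun a b c d Mx My u₀) (bijective_one_add_smul_mulVec
      (norm_matA_mulVec_le hγ0 hγ1 hab hcd hMx hMy) hτ hτC)
    fun k V => (1 - (τ / 2) • matA γ a b c d Mx My).mulVec V
      + τ • gridFun a b c d Mx My (fun x y => f x y (((k : ℝ) + 1 / 2) * τ))
      + τ • boundaryVec γ a b c d Mx My (fun x y => g x y (((k : ℝ) + 1 / 2) * τ))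
  exact ⟨U, ⟨h0, hs⟩, fun V hV => huniq V ⟨hV.start, hV.step⟩⟩

end Nonlocal2D

/-! ### The convergence theorem -/

theorem theorem3p14 (γ a b c d T : ℝ) (hγ0 : 0 < γ) (hγ1 : γ < 1) (hab : a < b) (hcd : c < d)
    (hT : 0 < T) (f g : ℝ → ℝ → ℝ → ℝ) (u₀ : ℝ → ℝ → ℝ) (u : ℝ → ℝ → ℝ → ℝ)
    (hu : Nonlocal2D.IsExactSolution γ a b c d T f g u₀ u)
    (hsmooth : Nonlocal2D.IsSmooth a b c d T u) :
    ∃ C : ℝ, ∀ (Mx My N : ℕ) (τ : ℝ), 1 ≤ Mx → 1 ≤ My → 0 < τ →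
      τ < 1 / (10 * Nonlocal2D.constCd γ a b c d) → N * τ ≤ T →
      (∃! U : Fin (N + 1) → Nonlocal2D.Index Mx My → ℝ,
        Nonlocal2D.IsSchemeSolution γ a b c d f g u₀ Mx My N τ U) ∧
      ∀ U : Fin (N + 1) → Nonlocal2D.Index Mx My → ℝ,
        Nonlocal2D.IsSchemeSolution γ a b c d f g u₀ Mx My N τ U →
        ∀ (k : Fin (N + 1)) (p : Nonlocal2D.Index Mx My),
          |u (Nonlocal2D.node a b Mx (p.1 + 1)) (Nonlocal2D.node c d My (p.2 + 1)) (k * τ)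
              - U k p|
            ≤ C * (τ ^ 2 + Nonlocal2D.meshSize a b Mx ^ (4 - γ)
                + Nonlocal2D.meshSize c d My ^ (4 - γ)) := by
  open Nonlocal2D in
  obtain ⟨B, hB⟩ := hsmooth.space_bound
  obtain ⟨B', hB'⟩ := hsmooth.time_bound
  have hCd := constCd_pos hγ1 hab hcd
  have h0T : (0 : ℝ) ∈ Icc 0 T := left_mem_Icc.2 hT.le
  have hB0 : 0 ≤ B := (norm_nonneg _).trans
    (hB _ h0T (a, c) ⟨left_mem_Icc.2 hab.le, left_mem_Icc.2 hcd.le⟩ 0 (by norm_num))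
  have hB'0 : 0 ≤ B' := (abs_nonneg _).trans
    (hB' a (left_mem_Icc.2 hab.le) c (left_mem_Icc.2 hcd.le) _ h0T 0 (by norm_num))
  have hba : 0 < b - a := sub_pos.2 hab
  have hdc : 0 < d - c := sub_pos.2 hcd
  have hγ' : 0 < 1 - γ := sub_pos.2 hγ1
  -- The uniform bound of the matrix; its reciprocal is the step size threshold τ₀.
  set L := 10 * constCd γ a b c d
  have hL : 0 < L := by positivity
  obtain ⟨κt, hκt⟩ : ∃ κt, κt = B' * (1 + L) := ⟨_, rfl⟩
  obtain ⟨κx, hκx⟩ : ∃ κx, κx = interpConst γ a b B * (d - c) := ⟨_, rfl⟩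
  obtain ⟨κy, hκy⟩ : ∃ κy, κy = 3 * interpConst γ c d B * (b - a) := ⟨_, rfl⟩
  have hκt0 : 0 ≤ κt := by rw [hκt]; positivity
  have hκx0 : 0 ≤ κx := by rw [hκx, interpConst]; positivity
  have hκy0 : 0 ≤ κy := by rw [hκy, interpConst]; positivity
  -- The Gronwall bound with elapsed time replaced by `T` and the residual by its constants times
  -- the sum of the three rates.
  refine ⟨Real.exp (2 * L * T) * (2 * (κt + κx + κy) * T),
    fun Mx My N τ hMx hMy hτ hτL hN => ?_⟩
  have hτL' : τ * L ≤ 1 := ((lt_div_iff₀ hL).1 hτL).le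
  refine ⟨existsUnique_schemeSolution hγ0 hγ1 hab hcd f g u₀ N hMx hMy hτ hτL',
    fun U hU k p => ?_⟩
  have hX : 0 ≤ meshSize a b Mx ^ (4 - γ) := Real.rpow_nonneg (meshSize_pos hab hMx).le _
  have hY : 0 ≤ meshSize c d My ^ (4 - γ) := Real.rpow_nonneg (meshSize_pos hcd hMy).le _
  have hres : ∀ k : Fin N, ‖stepResidual γ a b c d f g Mx My τ u k‖
      ≤ τ * (κt * τ ^ 2 + κx * meshSize a b Mx ^ (4 - γ) + κy * meshSize c d My ^ (4 - γ)) := by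
    intro k
    rw [hκt, hκx, hκy]
    refine norm_stepResidual_le hγ0 hγ1 hab hcd hu hsmooth hB hB' hMx hMy hτ (le_trans ?_ hN)
    have : ((k + 1 : ℕ) : ℝ) ≤ N := by exact_mod_cast k.2
    gcongr
  set R := κt * τ ^ 2 + κx * meshSize a b Mx ^ (4 - γ) + κy * meshSize c d My ^ (4 - γ)
  have hR0 : 0 ≤ R := by positivity
  have hgron := discrete_gronwall (R := R)
    (E := fun k : Fin (N + 1) =>
      ‖gridFun a b c d Mx My (fun x y => u x y ((k : ℕ) * τ)) - U k‖) hL.le hτ hτL' hR0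
    (fun k => norm_nonneg _) (by
      rw [hU.start, norm_eq_zero, sub_eq_zero]
      funext p
      simp only [gridFun, Fin.val_zero, Nat.cast_zero, zero_mul]
      -- The unknowns sit at interior nodes, where the initial condition holds, so the initial error
      -- vanishes.
      exact hu.initial _ _ ⟨index_node_mem hab hMx p.1, index_node_mem hcd hMy p.2⟩)
    (fun k => by
      conv_lhs => rw [error_step hU k]
      refine (norm_add_le _ _).trans (add_le_add ((norm_sub_le _ _).trans ?_) (hres k))
      refine add_le_add le_rfl ?_
      rw [norm_smul, Real.norm_of_nonneg (by linarith : 0 ≤ τ / 2), mul_assoc]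
      refine mul_le_mul_of_nonneg_left ?_ (by linarith)
      refine (norm_matA_mulVec_le hγ0 hγ1 hab hcd hMx hMy _).trans ?_
      exact mul_le_mul_of_nonneg_left (norm_add_le _ _) hL.le) k
  have hkT : (k : ℕ) * τ ≤ T := by
    refine le_trans ?_ hN
    have : ((k : ℕ) : ℝ) ≤ N := by exact_mod_cast Nat.lt_succ_iff.1 k.2
    gcongr
  have hRle : R ≤ (κt + κx + κy)
      * (τ ^ 2 + meshSize a b Mx ^ (4 - γ) + meshSize c d My ^ (4 - γ)) := by
    have h2 := sq_nonneg τ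
    nlinarith [mul_nonneg hκt0 hX, mul_nonneg hκt0 hY, mul_nonneg hκx0 h2, mul_nonneg hκx0 hY,
      mul_nonneg hκy0 h2, mul_nonneg hκy0 hX]
  calc |u (node a b Mx (p.1 + 1)) (node c d My (p.2 + 1)) (k * τ) - U k p|
      ≤ ‖gridFun a b c d Mx My (fun x y => u x y ((k : ℕ) * τ)) - U k‖ :=
        norm_le_pi_norm (gridFun a b c d Mx My (fun x y => u x y ((k : ℕ) * τ)) - U k) p
    _ ≤ Real.exp (2 * L * (k * τ)) * (2 * R * (k * τ)) := hgron
    _ ≤ Real.exp (2 * L * T) * (2 * ((κt + κx + κy)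
          * (τ ^ 2 + meshSize a b Mx ^ (4 - γ) + meshSize c d My ^ (4 - γ))) * T) := by
        gcongr
    _ = _ := by ring
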